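/- Let $q\in\mathbb C$ be a primitive $n$-th root of unity, $n\ge 3$, $n\neq 4$, and put $d=n$ if $n$ is odd, $d=n/2$ if $n$ is even. Let $\mathrm u_q=\mathrm u_q(\mathfrak{sl}_2(\mathbb C))$ be the $\mathbb C$-algebra generated by $E,F,K$ with relations $$E^d=F^d=0,\quad K^d=1,\quad KE=q^2EK,\quad KF=q^{-2}FK,\quad EF-FE=\frac{K-K^{-1}}{q-q^{-1}},$$ and let $\mathrm u_q^+$ be the subalgebra generated by $E$ and $K$. For $i\in\mathbb Z/d\mathbb Z$ and $0\le u\le d-1$ let $M_i^u$ be the $\mathrm u_q^+$-module with $\mathbb C$-basis $e^0,\dots,e^u$ and action $Ke^j=q^{2(i+j)}e^j$, $Ee^j=e^{j+1}$ for $j<u$, $Ee^u=0$; put $P_i=M_i^{d-1}$. For $a\in\mathbb Z/d\mathbb Z$ let $\overline a\in\{0,\dots,d-1\}$ be its representative. An extension of a $\mathrm u_q^+$-module $M$ is an action of $\mathrm u_q$ on the space $M$ whose restriction to $\mathrm u_q^+$ is the given action; $M$ is extendable if it has an extension. Two extensions are called isomorphic if they are isomorphic as $\mathrm u_q$-modules.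 **Theorem.** A $\mathrm u_q^+$-module is indecomposable and extendable if and only if it is isomorphic to $M_i^{\overline{-2i}}$ or to $P_i$ for some $i\in\mathbb Z/d\mathbb Z$; the modules in both families exist. Moreover: 1. Each $M_i^{\overline{-2i}}$ has exactly one extension, and this extension is a simple $\mathrm u_q$-module. Every simple $\mathrm u_q$-module restricts to $M_i^{\overline{-2i}}$, up to isomorphism, for exactly one $i\in\mathbb Z/d\mathbb Z$ (and is thus the extension of it). 2. Unless $d$ is odd and $i=\frac{d+1}{2}$, the module $P_i$ has two non-isomorphic extensions. More precisely, for every $c\in\mathbb C$ there is exactly one extension of $P_i$ with $Fe^0=c\,e^{d-1}$, every extension of $P_i$ is of this form, and distinct extensions are non-isomorphic. If $d$ is odd and $i=\frac{d+1}{2}$, then $P_i$ has exactly one extension. -/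

import Mathlib

universe v w

/-- The generators `E, F, K`. -/
inductive UqGen : Type
  | E | F | K

/-- The defining relations of the small quantum group. Since `K ^ d = 1`, the inverse of `K`
is `K ^ (d - 1)`. -/
inductive UqRel (q : ℂ) (d : ℕ) : FreeAlgebra ℂ UqGen → FreeAlgebra ℂ UqGen → Prop
  | E_pow : UqRel q d (FreeAlgebra.ι ℂ UqGen.E ^ d) 0
  | F_pow : UqRel q d (FreeAlgebra.ι ℂ UqGen.F ^ d) 0
  | K_pow : UqRel q d (FreeAlgebra.ι ℂ UqGen.K ^ d) 1
  | K_mul_E : UqRel q d (FreeAlgebra.ι ℂ UqGen.K * FreeAlgebra.ι ℂ UqGen.E)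
      (q ^ 2 • (FreeAlgebra.ι ℂ UqGen.E * FreeAlgebra.ι ℂ UqGen.K))
  | K_mul_F : UqRel q d (FreeAlgebra.ι ℂ UqGen.K * FreeAlgebra.ι ℂ UqGen.F)
      ((q ^ 2)⁻¹ • (FreeAlgebra.ι ℂ UqGen.F * FreeAlgebra.ι ℂ UqGen.K))
  | E_F : UqRel q d
      (FreeAlgebra.ι ℂ UqGen.E * FreeAlgebra.ι ℂ UqGen.F
        - FreeAlgebra.ι ℂ UqGen.F * FreeAlgebra.ι ℂ UqGen.E)
      ((q - q⁻¹)⁻¹ • (FreeAlgebra.ι ℂ UqGen.K - FreeAlgebra.ι ℂ UqGen.K ^ (d - 1)))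

/-- The algebra `u_q(sl₂(ℂ))`, presented by generators and relations. -/
abbrev Uq (q : ℂ) (d : ℕ) : Type := RingQuot (UqRel q d)

namespace Uq

/-- The image of a generator in `u_q`. -/
noncomputable def gen (q : ℂ) (d : ℕ) (x : UqGen) : Uq q d :=
  RingQuot.mkAlgHom ℂ (UqRel q d) (FreeAlgebra.ι ℂ x)

/-- The half-quantum group `u_q⁺`: the subalgebra of `u_q` generated by `E` and `K`. -/
noncomputable def plus (q : ℂ) (d : ℕ) : Subalgebra ℂ (Uq q d) :=
  Algebra.adjoin ℂ {gen q d UqGen.E, gen q d UqGen.K}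

/-- `E` as an element of `u_q⁺`. -/
noncomputable def plusE (q : ℂ) (d : ℕ) : plus q d :=
  ⟨gen q d UqGen.E, Algebra.subset_adjoin (Or.inl rfl)⟩

/-- `K` as an element of `u_q⁺`. -/
noncomputable def plusK (q : ℂ) (d : ℕ) : plus q d :=
  ⟨gen q d UqGen.K, Algebra.subset_adjoin (Or.inr rfl)⟩

/-- `e` is a standard basis `e⁰, …, eᵘ` for the pair `(i, u)`:
`K eʲ = q ^ (2 (i + j)) eʲ`, `E eʲ = eʲ⁺¹` for `j < u`, and `E eᵘ = 0`. -/
structure IsStandardBasis (q : ℂ) (d : ℕ) (i : ZMod d) (u : ℕ) {M : Type v} [AddCommGroup M]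
    [Module ℂ M] [Module (plus q d) M] (e : Module.Basis (Fin (u + 1)) ℂ M) : Prop where
  K_smul : ∀ j : Fin (u + 1), plusK q d • e j = q ^ (2 * (i.val + (j : ℕ))) • e j
  E_smul : ∀ j : Fin u, plusE q d • e j.castSucc = e j.succ
  E_smul_last : plusE q d • e (Fin.last u) = 0

/-- The `u_q⁺`-module `M` is (isomorphic to) the module `M_i^u`. -/
def IsTypeM (q : ℂ) (d : ℕ) (i : ZMod d) (u : ℕ) (M : Type v) [AddCommGroup M] [Module ℂ M]
    [Module (plus q d) M] : Prop :=
  ∃ e : Module.Basis (Fin (u + 1)) ℂ M, IsStandardBasis q d i u e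

/-- The `u_q⁺`-module `M` is (isomorphic to) the projective module `P_i = M_i^{d-1}`. -/
def IsTypeP (q : ℂ) (d : ℕ) (i : ZMod d) (M : Type v) [AddCommGroup M] [Module ℂ M]
    [Module (plus q d) M] : Prop :=
  IsTypeM q d i (d - 1) M

/-- A module is indecomposable if it is nonzero and is not the direct sum of two nonzero
submodules. -/
def IsIndecomposable (R : Type w) (M : Type v) [Ring R] [AddCommGroup M] [Module R M] : Prop :=
  Nontrivial M ∧ ∀ A B : Submodule R M, IsCompl A B → A = ⊥ ∨ B = ⊥

/-- An extension of a `u_q⁺`-module `M`: an action of `u_q` on the space `M` whose restriction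
to `u_q⁺` is the given action. -/
@[ext]
structure Extension (q : ℂ) (d : ℕ) (M : Type v) [AddCommGroup M] [Module ℂ M]
    [Module (plus q d) M] where
  /-- The action of `u_q`. -/
  act : Uq q d →ₐ[ℂ] Module.End ℂ M
  act_plus : ∀ (a : plus q d) (m : M), act (a : Uq q d) m = a • m

/-- `M` is extendable if the action of `u_q⁺` extends to an action of `u_q`. -/
def IsExtendable (q : ℂ) (d : ℕ) (M : Type v) [AddCommGroup M] [Module ℂ M]
    [Module (plus q d) M] : Prop :=
  Nonempty (Extension q d M)

namespace Extension

variable {q : ℂ} {d : ℕ} {M : Type v} [AddCommGroup M] [Module ℂ M] [Module (plus q d) M]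

/-- The space `M` with the `u_q`-module structure given by an extension. -/
def Carrier (_X : Extension q d M) : Type v := M

instance (X : Extension q d M) : AddCommGroup X.Carrier := inferInstanceAs (AddCommGroup M)

instance (X : Extension q d M) : Module (Uq q d) X.Carrier :=
  Module.compHom M X.act.toRingHom

/-- Two extensions of `M` are isomorphic if they are isomorphic as `u_q`-modules. -/
def Iso (X Y : Extension q d M) : Prop :=
  Nonempty (X.Carrier ≃ₗ[Uq q d] Y.Carrier)

end Extension

end Uq

/-!
Put `Q = q ^ 2`, a primitive `d`-th root of unity. A vector `v` with `K v = μ v` and `E F v = 0`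
generates a string `v, E v, E² v, …` on which the commutation relation forces
`F Eʲ⁺¹ v = a_{j+1} Eʲ v`, with scalars `a_j` (`Uq.lowerCoeff`) that are sums of two geometric
series. For `μ = Qⁱ`, such a scalar vanishes only if `j = 0` or `j = 1 - 2i` modulo `d`
(`Uq.lowerCoeff_eq_zero_iff`).

On `M_i^u` the vector `F e⁰` has weight `Qⁱ⁻¹`, so it is a multiple `c eᵘ`, and `c = 0` unless
`u = d - 1`. Hence `E F e⁰ = 0` and an extension is determined by `c`. Applying `F` to
`Eᵘ⁺¹ e⁰ = 0` gives `a_{u+1} = 0`, which means `u = d - 1` or `u = -2i`. Conversely, if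
`a_{u+1} = 0`, the formulas define an action, provided that `F ^ d = 0`: this holds if `c = 0`, or if
some `a_m` with `1 ≤ m ≤ u` vanishes, and fails otherwise
(`Uq.IsStringBasis.exists_isUqTriple`, `Uq.IsStringBasis.F_zero_eq_zero`). If no `a_m` vanishes,
which is the case for `u = -2i`, then `F` leads from the socle `eᵘ` to the whole module, so the
extension is simple. Extensions with different `c` are not isomorphic, because an endomorphism
of `M_i^u` is a scalar.

That the indecomposable `u_q⁺`-modules, of any dimension, are the `M_i^u` is seen by splitting off a
longest string (`Uq.IsBorelPair.exists_string_projection`): if `Eᵘ⁺¹ = 0` and `Eᵘ x ≠ 0` for a weight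
vector `x`, choose a weight functional `φ` with `φ (Eᵘ x) = 1`; then
`m ↦ ∑ j ≤ u, φ (Eᵘ⁻ʲ m) Eʲ x` is a `u_q⁺`-linear projection to the string of `x`. A simple
`u_q`-module is spanned by the string of any weight vector killed by `F`, which excludes
vanishing `a_m`.
-/

/-! ### Powers of a primitive root of unity and the structure constants -/

/-- Powers of a primitive `d`-th root of unity depend on, and determine, the exponent
in `ZMod d`. -/
theorem IsPrimitiveRoot.pow_eq_pow_iff_natCast_zmod_eq {Q : ℂ} {d : ℕ} [NeZero d]
    (hQ : IsPrimitiveRoot Q d) (a b : ℕ) : Q ^ a = Q ^ b ↔ (a : ZMod d) = b := by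
  rw [ZMod.natCast_eq_natCast_iff]
  obtain ⟨U, rfl⟩ := hQ.isUnit (NeZero.ne d)
  have hU : IsPrimitiveRoot U d := IsPrimitiveRoot.coe_units_iff.mp hQ
  rw [hU.eq_orderOf, ← pow_eq_pow_iff_modEq, ← Units.val_pow_eq_pow_val, ← Units.val_pow_eq_pow_val,
    Units.val_inj]

namespace Uq

theorem sub_inv_ne_zero {q : ℂ} (hq0 : q ≠ 0) (hq1 : q ^ 2 ≠ 1) : q - q⁻¹ ≠ 0 := by
  intro h
  apply hq1
  field_simp at h
  linear_combination h

/-- The scalar `a_j` for which `F Eʲ v = a_j Eʲ⁻¹ v`, whenever `K v = μ v` and `E F v = 0`. -/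
noncomputable def lowerCoeff (q μ : ℂ) (j : ℕ) : ℂ :=
  -∑ l ∈ Finset.range j, (q - q⁻¹)⁻¹ * (μ * (q ^ 2) ^ l - (μ * (q ^ 2) ^ l)⁻¹)

@[simp] theorem lowerCoeff_zero (q μ : ℂ) : lowerCoeff q μ 0 = 0 := by simp [lowerCoeff]

theorem lowerCoeff_succ (q μ : ℂ) (j : ℕ) : lowerCoeff q μ (j + 1) =
    lowerCoeff q μ j - (q - q⁻¹)⁻¹ * (μ * (q ^ 2) ^ j - (μ * (q ^ 2) ^ j)⁻¹) := by
  rw [lowerCoeff, Finset.sum_range_succ, lowerCoeff]; ring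

/-- The evaluation of the two geometric sums in `a_j`, with denominators cleared. -/
theorem lowerCoeff_closed_form {q μ : ℂ} (hq0 : q ≠ 0) (hq1 : q ^ 2 ≠ 1) (hμ : μ ≠ 0) (j : ℕ) :
    (q - q⁻¹) * (q ^ 2 - 1) * (μ * (q ^ 2) ^ j) * lowerCoeff q μ j =
      -(((q ^ 2) ^ j - 1) * (μ ^ 2 * (q ^ 2) ^ j - q ^ 2)) := by
  have hQ0 : q ^ 2 ≠ 0 := pow_ne_zero _ hq0
  have hqq := sub_inv_ne_zero hq0 hq1
  induction j with
  | zero => simp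
  | succ j ih =>
    rw [lowerCoeff_succ, pow_succ (q ^ 2) j]
    generalize q ^ 2 = Q at *
    have hX : Q ^ j ≠ 0 := pow_ne_zero _ hQ0
    generalize Q ^ j = X at *
    generalize lowerCoeff q μ j = a at *
    have hc : (q - q⁻¹) * (q - q⁻¹)⁻¹ = 1 := mul_inv_cancel₀ hqq
    have hm : (μ * X) * (μ * X)⁻¹ = 1 := mul_inv_cancel₀ (mul_ne_zero hμ hX)
    generalize (q - q⁻¹)⁻¹ = r at *
    generalize (μ * X)⁻¹ = s at *
    generalize q - q⁻¹ = p at *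
    linear_combination Q * ih - (Q - 1) * μ * X * Q * (μ * X - s) * hc + (Q - 1) * Q * hm

/-- The structure constant `a_j` of weight `q ^ (2 * i)` vanishes only for `j = 0` and
`j = 1 - 2 * i` modulo `d`. -/
theorem lowerCoeff_eq_zero_iff {q : ℂ} {d : ℕ} [NeZero d] (hQ : IsPrimitiveRoot (q ^ 2) d)
    (hd : 2 ≤ d) (i : ZMod d) (j : ℕ) :
    lowerCoeff q ((q ^ 2) ^ i.val) j = 0 ↔ (j : ZMod d) = 0 ∨ 2 * i + j = 1 := by
  have hQ0 : q ^ 2 ≠ 0 := hQ.ne_zero (NeZero.ne d)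
  have hq0 : q ≠ 0 := fun h => hQ0 (by simp [h])
  have hq1 : q ^ 2 ≠ 1 := hQ.ne_one hd
  have hμ : (q ^ 2) ^ i.val ≠ 0 := pow_ne_zero _ hQ0
  have key := lowerCoeff_closed_form hq0 hq1 hμ j
  have h1 : (q - q⁻¹) * (q ^ 2 - 1) * ((q ^ 2) ^ i.val * (q ^ 2) ^ j) ≠ 0 :=
    mul_ne_zero (mul_ne_zero (sub_inv_ne_zero hq0 hq1) (sub_ne_zero.mpr hq1))
      (mul_ne_zero hμ (pow_ne_zero _ hQ0))
  have h2 := hQ.pow_eq_pow_iff_natCast_zmod_eq j 0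
  have h3 := hQ.pow_eq_pow_iff_natCast_zmod_eq (i.val * 2 + j) 1
  rw [pow_zero, Nat.cast_zero] at h2
  rw [pow_one, pow_add, pow_mul] at h3
  push_cast at h3
  rw [ZMod.natCast_zmod_val, mul_comm i 2] at h3
  rw [← h2, ← h3]
  constructor
  · intro h
    rw [h, mul_zero, eq_comm, neg_eq_zero, mul_eq_zero, sub_eq_zero, sub_eq_zero] at key
    exact key
  · intro h
    rw [← sub_eq_zero, ← sub_eq_zero (b := q ^ 2), ← mul_eq_zero] at h
    rw [h, neg_zero] at key
    exact (mul_eq_zero.mp key).resolve_left h1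

end Uq

/-! ### Representations as tuples of endomorphisms -/

namespace Uq

variable {V : Type v} [AddCommGroup V] [Module ℂ V]

/-- The relations of `u_q⁺` between two endomorphisms, where `Q` stands for `q ^ 2`. -/
structure IsBorelPair (Q : ℂ) (d : ℕ) (E K : Module.End ℂ V) : Prop where
  E_pow : E ^ d = 0
  K_pow : K ^ d = 1
  K_mul_E : K * E = Q • (E * K)

/-- The relations of `u_q` between three endomorphisms. -/
structure IsUqTriple (q : ℂ) (d : ℕ) (E F K : Module.End ℂ V) : Prop
    extends IsBorelPair (q ^ 2) d E K where
  F_pow : F ^ d = 0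
  K_mul_F : K * F = (q ^ 2)⁻¹ • (F * K)
  E_F : E * F - F * E = (q - q⁻¹)⁻¹ • (K - K ^ (d - 1))

section Algebra

variable {A : Type w} [Ring A] [Algebra ℂ A] (q : ℂ) (d : ℕ)

theorem gen_E_pow : gen q d UqGen.E ^ d = 0 := by
  simpa [gen] using RingQuot.mkAlgHom_rel ℂ (UqRel.E_pow (q := q) (d := d))

theorem gen_F_pow : gen q d UqGen.F ^ d = 0 := by
  simpa [gen] using RingQuot.mkAlgHom_rel ℂ (UqRel.F_pow (q := q) (d := d))

theorem gen_K_pow : gen q d UqGen.K ^ d = 1 := by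
  simpa [gen] using RingQuot.mkAlgHom_rel ℂ (UqRel.K_pow (q := q) (d := d))

theorem gen_K_mul_E : gen q d UqGen.K * gen q d UqGen.E =
    q ^ 2 • (gen q d UqGen.E * gen q d UqGen.K) := by
  simpa only [gen, map_mul, map_smul] using
    RingQuot.mkAlgHom_rel ℂ (UqRel.K_mul_E (q := q) (d := d))

theorem gen_K_mul_F : gen q d UqGen.K * gen q d UqGen.F =
    (q ^ 2)⁻¹ • (gen q d UqGen.F * gen q d UqGen.K) := by
  simpa only [gen, map_mul, map_smul] using
    RingQuot.mkAlgHom_rel ℂ (UqRel.K_mul_F (q := q) (d := d))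

theorem gen_E_F : gen q d UqGen.E * gen q d UqGen.F - gen q d UqGen.F * gen q d UqGen.E =
    (q - q⁻¹)⁻¹ • (gen q d UqGen.K - gen q d UqGen.K ^ (d - 1)) := by
  simpa only [gen, map_mul, map_smul, map_sub, map_pow] using
    RingQuot.mkAlgHom_rel ℂ (UqRel.E_F (q := q) (d := d))

variable {q d}

theorem isUqTriple_of_algHom (ρ : Uq q d →ₐ[ℂ] Module.End ℂ V) :
    IsUqTriple q d (ρ (gen q d UqGen.E)) (ρ (gen q d UqGen.F)) (ρ (gen q d UqGen.K)) where
  E_pow := by rw [← map_pow, gen_E_pow, map_zero]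
  F_pow := by rw [← map_pow, gen_F_pow, map_zero]
  K_pow := by rw [← map_pow, gen_K_pow, map_one]
  K_mul_E := by rw [← map_mul, gen_K_mul_E, map_smul, map_mul]
  K_mul_F := by rw [← map_mul, gen_K_mul_F, map_smul, map_mul]
  E_F := by rw [← map_mul, ← map_mul, ← map_sub, gen_E_F, map_smul, map_sub, map_pow]

/-- A family of endomorphisms indexed by the generators. -/
def genMap (E F K : Module.End ℂ V) : UqGen → Module.End ℂ V
  | UqGen.E => E
  | UqGen.F => F
  | UqGen.K => K

theorem IsUqTriple.exists_algHom {E F K : Module.End ℂ V} (h : IsUqTriple q d E F K) :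
    ∃ ρ : Uq q d →ₐ[ℂ] Module.End ℂ V, ρ (gen q d UqGen.E) = E ∧ ρ (gen q d UqGen.F) = F ∧
      ρ (gen q d UqGen.K) = K := by
  have hw : ∀ ⦃x y : FreeAlgebra ℂ UqGen⦄, UqRel q d x y →
      FreeAlgebra.lift ℂ (genMap E F K) x = FreeAlgebra.lift ℂ (genMap E F K) y := by
    intro x y hxy
    cases hxy with
    | E_pow => simpa [genMap] using h.E_pow
    | F_pow => simpa [genMap] using h.F_pow
    | K_pow => simpa [genMap] using h.K_pow
    | K_mul_E =>
      simpa only [map_mul, map_smul, FreeAlgebra.lift_ι_apply, genMap] using h.K_mul_E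
    | K_mul_F =>
      simpa only [map_mul, map_smul, FreeAlgebra.lift_ι_apply, genMap] using h.K_mul_F
    | E_F =>
      simpa only [map_mul, map_smul, map_sub, map_pow, FreeAlgebra.lift_ι_apply, genMap] using h.E_F
  refine ⟨RingQuot.liftAlgHom ℂ ⟨FreeAlgebra.lift ℂ (genMap E F K), hw⟩, ?_, ?_, ?_⟩ <;>
  · rw [gen, RingQuot.liftAlgHom_mkAlgHom_apply, FreeAlgebra.lift_ι_apply, genMap]

theorem algHom_ext {ρ σ : Uq q d →ₐ[ℂ] A} (h : ∀ x, ρ (gen q d x) = σ (gen q d x)) : ρ = σ := by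
  apply RingQuot.ringQuot_ext'
  apply FreeAlgebra.hom_ext
  funext x
  exact h x

theorem plus_induction {p : plus q d → Prop} (hE : p (plusE q d)) (hK : p (plusK q d))
    (hC : ∀ c : ℂ, p (algebraMap ℂ (plus q d) c)) (hadd : ∀ x y, p x → p y → p (x + y))
    (hmul : ∀ x y, p x → p y → p (x * y)) (x : plus q d) : p x := by
  obtain ⟨x, hx⟩ := x
  induction hx using Algebra.adjoin_induction with
  | mem x hx =>
    rcases hx with rfl | rfl
    · exact hE
    · exact hK
  | algebraMap r => exact hC r
  | add x y hx hy ihx ihy => exact hadd _ _ ihx ihy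
  | mul x y hx hy ihx ihy => exact hmul _ _ ihx ihy

theorem gen_induction {p : Uq q d → Prop} (hgen : ∀ x, p (gen q d x))
    (hC : ∀ c : ℂ, p (algebraMap ℂ (Uq q d) c)) (hadd : ∀ x y, p x → p y → p (x + y))
    (hmul : ∀ x y, p x → p y → p (x * y)) (x : Uq q d) : p x := by
  obtain ⟨x, rfl⟩ := RingQuot.mkAlgHom_surjective ℂ (UqRel q d) x
  induction x using FreeAlgebra.induction with
  | grade0 r => rw [AlgHom.commutes]; exact hC r
  | grade1 x => exact hgen x
  | mul a b ha hb => rw [map_mul]; exact hmul _ _ ha hb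
  | add a b ha hb => rw [map_add]; exact hadd _ _ ha hb

end Algebra

section PlusModule

variable (q : ℂ) (d : ℕ) (M : Type v) [AddCommGroup M] [Module ℂ M] [Module (plus q d) M]
  [IsScalarTower ℂ (plus q d) M]

/-- The action of `E` on a `u_q⁺`-module. -/
noncomputable def endE : Module.End ℂ M := Algebra.lsmul ℂ ℂ M (plusE q d)

/-- The action of `K` on a `u_q⁺`-module. -/
noncomputable def endK : Module.End ℂ M := Algebra.lsmul ℂ ℂ M (plusK q d)

variable {M}

theorem endE_apply (m : M) : endE q d M m = plusE q d • m := rfl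

theorem endK_apply (m : M) : endK q d M m = plusK q d • m := rfl

variable (M)

theorem isBorelPair_end : IsBorelPair (q ^ 2) d (endE q d M) (endK q d M) where
  E_pow := by
    rw [endE, ← map_pow, show plusE q d ^ d = 0 from Subtype.ext (gen_E_pow q d), map_zero]
  K_pow := by
    rw [endK, ← map_pow, show plusK q d ^ d = 1 from Subtype.ext (gen_K_pow q d), map_one]
  K_mul_E := by
    rw [endE, endK, ← map_mul, show plusK q d * plusE q d = q ^ 2 • (plusE q d * plusK q d) from
      Subtype.ext (gen_K_mul_E q d), map_smul, map_mul]

variable {q d M}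

/-- A linear map commuting with `E` and `K` is `u_q⁺`-linear. -/
theorem map_plus_smul {f : M →ₗ[ℂ] M} (hE : ∀ m, f (endE q d M m) = endE q d M (f m))
    (hK : ∀ m, f (endK q d M m) = endK q d M (f m)) (a : plus q d) (m : M) :
    f (a • m) = a • f m := by
  induction a using plus_induction generalizing m with
  | hE => exact hE m
  | hK => exact hK m
  | hC c => rw [algebraMap_smul, algebraMap_smul, map_smul]
  | hadd x y hx hy => rw [add_smul, add_smul, map_add, hx, hy]
  | hmul x y hx hy => rw [mul_smul, mul_smul, hx, hy]

theorem Extension.act_E (X : Extension q d M) : X.act (gen q d UqGen.E) = endE q d M :=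
  LinearMap.ext fun m => X.act_plus (plusE q d) m

theorem Extension.act_K (X : Extension q d M) : X.act (gen q d UqGen.K) = endK q d M :=
  LinearMap.ext fun m => X.act_plus (plusK q d) m

theorem Extension.isUqTriple (X : Extension q d M) :
    IsUqTriple q d (endE q d M) (X.act (gen q d UqGen.F)) (endK q d M) := by
  rw [← X.act_E, ← X.act_K]
  exact isUqTriple_of_algHom X.act

theorem Extension.eq_of_act_F_eq {X Y : Extension q d M}
    (h : X.act (gen q d UqGen.F) = Y.act (gen q d UqGen.F)) : X = Y := by
  ext1
  apply algHom_ext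
  rintro (_ | _ | _)
  · rw [X.act_E, Y.act_E]
  · exact h
  · rw [X.act_K, Y.act_K]

theorem exists_extension {F : Module.End ℂ M}
    (h : IsUqTriple q d (endE q d M) F (endK q d M)) :
    ∃ X : Extension q d M, X.act (gen q d UqGen.F) = F := by
  obtain ⟨ρ, hE, hF, hK⟩ := h.exists_algHom
  refine ⟨⟨ρ, fun a => ?_⟩, hF⟩
  induction a using plus_induction with
  | hE => intro m; exact LinearMap.congr_fun hE m
  | hK => intro m; exact LinearMap.congr_fun hK m
  | hC c =>
    intro m
    rw [algebraMap_smul]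
    exact LinearMap.congr_fun (ρ.commutes c) m
  | hadd x y hx hy =>
    intro m
    rw [Subalgebra.coe_add, map_add, LinearMap.add_apply, hx, hy, add_smul]
  | hmul x y hx hy =>
    intro m
    rw [Subalgebra.coe_mul, map_mul, Module.End.mul_apply, hy, hx, mul_smul]

end PlusModule

end Uq

/-! ### Strings of weight vectors -/

namespace Uq

variable {V : Type v} [AddCommGroup V] [Module ℂ V] {q Q μ : ℂ} {d u : ℕ}
  {E F K : Module.End ℂ V}

theorem pow_apply_of_weight {x : V} (hx : K x = μ • x) (n : ℕ) : (K ^ n) x = μ ^ n • x := by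
  induction n with
  | zero => simp
  | succ n ih => rw [pow_succ, Module.End.mul_apply, hx, map_smul, ih, smul_smul, pow_succ']

theorem IsBorelPair.weight_pow_eq_one (h : IsBorelPair Q d E K) {x : V} (hx : K x = μ • x)
    (hx0 : x ≠ 0) : μ ^ d = 1 := by
  have h1 := pow_apply_of_weight hx d
  rw [h.K_pow, Module.End.one_apply] at h1
  have h2 : (μ ^ d - 1) • x = 0 := by rw [sub_smul, one_smul, ← h1, sub_self]
  exact sub_eq_zero.mp ((smul_eq_zero.mp h2).resolve_right hx0)

theorem IsBorelPair.weight_E_pow (h : IsBorelPair Q d E K) {x : V} (hx : K x = μ • x) (j : ℕ) :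
    K ((E ^ j) x) = (μ * Q ^ j) • (E ^ j) x := by
  induction j with
  | zero => simpa using hx
  | succ j ih =>
    rw [pow_succ', Module.End.mul_apply, ← Module.End.mul_apply, h.K_mul_E, LinearMap.smul_apply,
      Module.End.mul_apply, ih, map_smul, smul_smul]
    ring_nf

theorem IsUqTriple.weight_F (h : IsUqTriple q d E F K) {x : V} (hx : K x = μ • x) :
    K (F x) = (μ * (q ^ 2)⁻¹) • F x := by
  rw [← Module.End.mul_apply, h.K_mul_F, LinearMap.smul_apply, Module.End.mul_apply, hx, map_smul,
    smul_smul, mul_comm]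

theorem E_pow_ne_zero_of_le {x : V} (hx : (E ^ u) x ≠ 0) {j : ℕ} (hj : j ≤ u) :
    (E ^ j) x ≠ 0 :=
  fun h => hx (Module.End.pow_map_zero_of_le hj h)

theorem end_pow_succ_apply (T : Module.End ℂ V) (j : ℕ) (x : V) :
    (T ^ (j + 1)) x = T ((T ^ j) x) := by
  rw [pow_succ', Module.End.mul_apply]

/-- The commutation relation between `E` and `F` on a weight vector. -/
theorem IsUqTriple.E_F_apply (h : IsUqTriple q d E F K) (hd : 1 ≤ d) {x : V}
    (hx : K x = μ • x) : E (F x) - F (E x) = ((q - q⁻¹)⁻¹ * (μ - μ⁻¹)) • x := by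
  by_cases hx0 : x = 0
  · simp [hx0]
  have hμd := h.weight_pow_eq_one hx hx0
  have hμ : μ ^ (d - 1) = μ⁻¹ := by
    apply eq_inv_of_mul_eq_one_left
    rw [← pow_succ, Nat.sub_add_cancel hd, hμd]
  rw [← Module.End.mul_apply, ← Module.End.mul_apply, ← LinearMap.sub_apply, h.E_F,
    LinearMap.smul_apply, LinearMap.sub_apply, pow_apply_of_weight hx, hx, hμ, ← sub_smul, smul_smul]

/-- `F` lowers the string of a weight vector `v` with `E F v = 0`; this determines the action of
`F` on the whole string but for its first vector. -/
theorem IsUqTriple.F_E_pow_succ (h : IsUqTriple q d E F K) (hd : 1 ≤ d) {x : V}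
    (hx : K x = μ • x) (hEF : E (F x) = 0) (j : ℕ) :
    F ((E ^ (j + 1)) x) = lowerCoeff q μ (j + 1) • (E ^ j) x := by
  have key : ∀ j, E (F ((E ^ j) x)) = lowerCoeff q μ j • (E ^ j) x →
      F ((E ^ (j + 1)) x) = lowerCoeff q μ (j + 1) • (E ^ j) x := by
    intro j hj
    have h1 := h.E_F_apply hd (h.weight_E_pow hx j)
    rw [hj, ← end_pow_succ_apply, sub_eq_iff_eq_add', ← sub_eq_iff_eq_add, ← sub_smul,
      ← lowerCoeff_succ] at h1
    exact h1.symm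
  have all : ∀ j, E (F ((E ^ j) x)) = lowerCoeff q μ j • (E ^ j) x := by
    intro j
    induction j with
    | zero => simpa using hEF
    | succ j ih => rw [key j ih, map_smul, ← end_pow_succ_apply]
  exact key j (all j)

theorem linearIndependent_string [NeZero d] (hQ : IsPrimitiveRoot Q d) (h : IsBorelPair Q d E K)
    (hu : u < d) {x : V} (hx : K x = μ • x) (hxu : (E ^ u) x ≠ 0) :
    LinearIndependent ℂ (fun j : Fin (u + 1) => (E ^ (j : ℕ)) x) := by
  have hx0 : x ≠ 0 := by
    rintro rfl
    simp at hxu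
  have hμ : μ ≠ 0 := by
    rintro rfl
    have := h.weight_pow_eq_one hx hx0
    simp [NeZero.ne d] at this
  refine Module.End.eigenvectors_linearIndependent' K (fun j : Fin (u + 1) => μ * Q ^ (j : ℕ)) ?_ _
    fun j => ⟨Module.End.mem_eigenspace_iff.mpr (h.weight_E_pow hx j),
      E_pow_ne_zero_of_le hxu (Nat.lt_succ_iff.mp j.2)⟩
  intro a b hab
  exact Fin.ext (hQ.pow_inj (by omega) (by omega) (mul_left_cancel₀ hμ hab))

/-- The basis `e` of `V` is the string `v, E v, …, Eᵘ v` of a vector `v` of weight `μ`, and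
`Eᵘ⁺¹ v = 0`. -/
structure IsStringBasis (E K : Module.End ℂ V) (μ : ℂ) {u : ℕ}
    (e : Module.Basis (Fin (u + 1)) ℂ V) : Prop where
  apply_eq : ∀ j, e j = (E ^ (j : ℕ)) (e 0)
  weight : K (e 0) = μ • e 0
  pow_succ_eq_zero : (E ^ (u + 1)) (e 0) = 0

namespace IsStringBasis

variable {e : Module.Basis (Fin (u + 1)) ℂ V}

theorem last_eq (he : IsStringBasis E K μ e) : e (Fin.last u) = (E ^ u) (e 0) := by
  simpa using he.apply_eq (Fin.last u)

theorem pow_eq_zero (he : IsStringBasis E K μ e) {j : ℕ} (hj : u < j) : (E ^ j) (e 0) = 0 :=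
  Module.End.pow_map_zero_of_le hj he.pow_succ_eq_zero

theorem E_last (he : IsStringBasis E K μ e) : E (e (Fin.last u)) = 0 := by
  rw [he.last_eq, ← end_pow_succ_apply, he.pow_succ_eq_zero]

theorem linearMap_ext (he : IsStringBasis E K μ e) {f g : Module.End ℂ V}
    (hfg : ∀ j, f ((E ^ j) (e 0)) = g ((E ^ j) (e 0))) : f = g := by
  refine e.ext fun j => ?_
  rw [he.apply_eq]
  exact hfg j

theorem E_pow_eq_zero (he : IsStringBasis E K μ e) : E ^ (u + 1) = 0 := by
  refine he.linearMap_ext fun j => ?_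
  rw [← Module.End.mul_apply, ← pow_add, he.pow_eq_zero (by omega), LinearMap.zero_apply]

theorem repr_K (he : IsStringBasis E K μ e) (h : IsBorelPair Q d E K) (x : V)
    (j : Fin (u + 1)) : e.repr (K x) j = μ * Q ^ (j : ℕ) * e.repr x j := by
  have : e.coord j ∘ₗ K = (μ * Q ^ (j : ℕ)) • e.coord j := by
    refine e.ext fun k => ?_
    simp only [LinearMap.comp_apply, LinearMap.smul_apply]
    rw [he.apply_eq k, h.weight_E_pow he.weight, ← he.apply_eq k, map_smul, Module.Basis.coord_apply,
      Module.Basis.repr_self, smul_eq_mul, smul_eq_mul]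
    rcases eq_or_ne k j with rfl | hkj
    · rfl
    · simp [hkj]
  exact LinearMap.congr_fun this x

/-- The kernel of `E` is spanned by the last vector of the string. -/
theorem exists_eq_smul_last (he : IsStringBasis E K μ e) {x : V} (hx : E x = 0) :
    ∃ c : ℂ, x = c • e (Fin.last u) := by
  refine ⟨e.repr x (Fin.last u), ?_⟩
  have h1 : ∀ j : Fin u, e.repr x j.castSucc = 0 := by
    have h2 : ∑ j : Fin u, e.repr x j.castSucc • e j.succ = 0 := by
      rw [← hx]
      conv_rhs => rw [← e.sum_repr x]
      rw [Fin.sum_univ_castSucc, map_add, map_smul, he.E_last, smul_zero, add_zero, map_sum]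
      refine Finset.sum_congr rfl fun j _ => ?_
      rw [map_smul, he.apply_eq j.succ, he.apply_eq j.castSucc, ← end_pow_succ_apply]
      simp
    have h3 : LinearIndependent ℂ (fun j : Fin u => e j.succ) :=
      e.linearIndependent.comp _ (Fin.succ_injective u)
    exact Fintype.linearIndependent_iff.mp h3 _ h2
  conv_lhs => rw [← e.sum_repr x]
  rw [Fin.sum_univ_castSucc]
  simp [h1]

/-- The last vector of the string spans the socle. -/
theorem last_mem (he : IsStringBasis E K μ e) {W : Submodule ℂ V} (hW : ∀ x ∈ W, E x ∈ W)
    (hW0 : W ≠ ⊥) : e (Fin.last u) ∈ W := by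
  obtain ⟨x, hxW, hx0⟩ := W.ne_bot_iff.mp hW0
  have hmem : ∀ k, (E ^ k) x ∈ W := by
    intro k
    induction k with
    | zero => simpa using hxW
    | succ k ih => rw [end_pow_succ_apply]; exact hW _ ih
  have hex : ∃ k, (E ^ k) x = 0 := ⟨u + 1, by rw [he.E_pow_eq_zero, LinearMap.zero_apply]⟩
  classical
  obtain ⟨k, hk⟩ : ∃ k, Nat.find hex = k + 1 := by
    refine Nat.exists_eq_succ_of_ne_zero fun h0 => hx0 ?_
    simpa using (Nat.find_eq_zero hex).mp h0
  have h0 := Nat.find_spec hex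
  have h1 := Nat.find_min hex (m := k) (by omega)
  rw [hk, end_pow_succ_apply] at h0
  obtain ⟨c, hc⟩ := he.exists_eq_smul_last h0
  have hc0 : c ≠ 0 := by
    rintro rfl
    exact h1 (by simpa using hc)
  have h2 := W.smul_mem c⁻¹ (hmem k)
  rwa [hc, smul_smul, inv_mul_cancel₀ hc0, one_smul] at h2

theorem weight_ne_zero [NeZero d] (he : IsStringBasis E K μ e) (h : IsBorelPair Q d E K) :
    μ ≠ 0 := by
  rintro rfl
  have := h.weight_pow_eq_one he.weight (e.ne_zero 0)
  simp [NeZero.ne d] at this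

/-- A weight vector is a multiple of the `j`-th vector of the string, if no other vector of the
string has the same weight. -/
theorem eq_smul_of_weight (he : IsStringBasis E K μ e) (h : IsBorelPair Q d E K)
    {ν : ℂ} {x : V} (hx : K x = ν • x) (j : Fin (u + 1)) (hj : ∀ k ≠ j, μ * Q ^ (k : ℕ) ≠ ν) :
    x = e.repr x j • e j := by
  apply e.repr.injective
  ext k
  rw [map_smul, Finsupp.smul_apply, Module.Basis.repr_self]
  rcases eq_or_ne k j with rfl | hkj
  · simp
  · have h1 := he.repr_K h x k
    rw [hx, map_smul, Finsupp.smul_apply, smul_eq_mul, ← sub_eq_zero, ← sub_mul] at h1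
    rw [(mul_eq_zero.mp h1).resolve_left (sub_ne_zero.mpr (hj k hkj).symm)]
    simp [hkj.symm]

/-- The length and the weight of a string basis are determined by the module. -/
theorem unique (he : IsStringBasis E K μ e) {μ' : ℂ} {u' : ℕ}
    {e' : Module.Basis (Fin (u' + 1)) ℂ V} (he' : IsStringBasis E K μ' e')
    (h : IsBorelPair Q d E K) (hQ0 : Q ≠ 0) : u = u' ∧ μ = μ' := by
  have huu : u = u' := by
    have h1 := Module.finrank_eq_card_basis e
    have h2 := Module.finrank_eq_card_basis e'
    simp only [Fintype.card_fin] at h1 h2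
    omega
  subst huu
  refine ⟨rfl, ?_⟩
  obtain ⟨c, hc⟩ := he'.exists_eq_smul_last he.E_last
  have h1 := h.weight_E_pow he.weight u
  have h2 := h.weight_E_pow he'.weight u
  rw [← he.last_eq] at h1
  rw [← he'.last_eq] at h2
  have h3 : (μ * Q ^ u - μ' * Q ^ u) • e (Fin.last u) = 0 := by
    rw [sub_smul, ← h1, hc, map_smul, h2, smul_comm, sub_self]
  have h4 := (smul_eq_zero.mp h3).resolve_right (e.ne_zero _)
  exact mul_right_cancel₀ (pow_ne_zero u hQ0) (sub_eq_zero.mp h4)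

/-- An endomorphism commuting with `E` and `K` is a scalar. -/
theorem eq_smul_of_commute [NeZero d] (he : IsStringBasis E K μ e) (h : IsBorelPair Q d E K)
    (hQ : IsPrimitiveRoot Q d) (hud : u < d) {f : Module.End ℂ V}
    (hE : ∀ x, f (E x) = E (f x)) (hK : ∀ x, f (K x) = K (f x)) : ∃ c : ℂ, ∀ x, f x = c • x := by
  have h1 : K (f (e 0)) = μ • f (e 0) := by rw [← hK, he.weight, map_smul]
  have h2 := he.eq_smul_of_weight h h1 0 (by
    intro k hk hμ
    refine hk (Fin.ext (hQ.pow_inj (by omega) (NeZero.pos d) ?_))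
    exact mul_left_cancel₀ (he.weight_ne_zero h) (by simpa using hμ))
  refine ⟨e.repr (f (e 0)) 0, fun x => ?_⟩
  have h3 : f = e.repr (f (e 0)) 0 • (1 : Module.End ℂ V) := by
    refine he.linearMap_ext fun j => ?_
    rw [LinearMap.smul_apply, Module.End.one_apply]
    induction j with
    | zero => simpa using h2
    | succ j ih => rw [end_pow_succ_apply, hE, ih, map_smul]
  conv_lhs => rw [h3]
  rfl

/-- On the first vector of a string basis, `F` is zero unless the string has length `d`; then it
returns to a multiple of the last vector. -/
theorem exists_F_zero [NeZero d] (he : IsStringBasis E K μ e) (h : IsUqTriple q d E F K)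
    (hQ : IsPrimitiveRoot (q ^ 2) d) (hud : u < d) :
    ∃ c : ℂ, F (e 0) = c • e (Fin.last u) ∧ (u + 1 = d ∨ c = 0) := by
  have hQ0 : q ^ 2 ≠ 0 := hQ.ne_zero (NeZero.ne d)
  have hμ := he.weight_ne_zero h.toIsBorelPair
  have h1 := h.weight_F he.weight
  have h2 : ∀ k : Fin (u + 1), (k : ℕ) + 1 ≠ d → μ * (q ^ 2) ^ (k : ℕ) ≠ μ * (q ^ 2)⁻¹ := by
    intro k hk hμk
    have h3 : (q ^ 2) ^ ((k : ℕ) + 1) = 1 := by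
      rw [pow_succ, mul_left_cancel₀ hμ hμk, inv_mul_cancel₀ hQ0]
    have := Nat.le_of_dvd (Nat.succ_pos _) ((hQ.pow_eq_one_iff_dvd _).mp h3)
    omega
  have h4 := he.eq_smul_of_weight h.toIsBorelPair h1 (Fin.last u) (by
    intro k hk
    refine h2 k ?_
    have := Fin.val_lt_last hk
    omega)
  refine ⟨_, h4, ?_⟩
  by_contra! hcon
  have h5 := he.repr_K h.toIsBorelPair (F (e 0)) (Fin.last u)
  rw [h1, map_smul, Finsupp.smul_apply, smul_eq_mul] at h5
  exact h2 (Fin.last u) (by simpa using hcon.1) (mul_right_cancel₀ hcon.2 h5.symm)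

theorem E_F_zero [NeZero d] (he : IsStringBasis E K μ e) (h : IsUqTriple q d E F K)
    (hQ : IsPrimitiveRoot (q ^ 2) d) (hud : u < d) : E (F (e 0)) = 0 := by
  obtain ⟨c, hc, -⟩ := he.exists_F_zero h hQ hud
  rw [hc, map_smul, he.E_last, smul_zero]

theorem F_succ [NeZero d] (he : IsStringBasis E K μ e) (h : IsUqTriple q d E F K)
    (hQ : IsPrimitiveRoot (q ^ 2) d) (hud : u < d) (j : ℕ) :
    F ((E ^ (j + 1)) (e 0)) = lowerCoeff q μ (j + 1) • (E ^ j) (e 0) :=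
  h.F_E_pow_succ (NeZero.pos d) he.weight (he.E_F_zero h hQ hud) j

theorem lowerCoeff_succ_eq_zero [NeZero d] (he : IsStringBasis E K μ e)
    (h : IsUqTriple q d E F K) (hQ : IsPrimitiveRoot (q ^ 2) d) (hud : u < d) :
    lowerCoeff q μ (u + 1) = 0 := by
  have h1 := he.F_succ h hQ hud u
  rw [he.pow_succ_eq_zero, map_zero, ← he.last_eq] at h1
  exact (smul_eq_zero.mp h1.symm).resolve_right (e.ne_zero _)

/-- The action of `F` is determined by its value on the first vector. -/
theorem F_unique [NeZero d] (he : IsStringBasis E K μ e) {F' : Module.End ℂ V}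
    (h : IsUqTriple q d E F K) (h' : IsUqTriple q d E F' K) (hQ : IsPrimitiveRoot (q ^ 2) d)
    (hud : u < d) (h0 : F (e 0) = F' (e 0)) : F = F' := by
  refine he.linearMap_ext fun j => ?_
  cases j with
  | zero => simpa using h0
  | succ j => rw [he.F_succ h hQ hud, he.F_succ h' hQ hud]

/-- If no structure constant vanishes, then `F` kills the first vector: otherwise `F` would
permute the lines of the string cyclically, against its nilpotency. -/
theorem F_zero_eq_zero [NeZero d] (he : IsStringBasis E K μ e) (h : IsUqTriple q d E F K)
    (hQ : IsPrimitiveRoot (q ^ 2) d) (hud : u < d)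
    (ha : ∀ m, 1 ≤ m → m ≤ u → lowerCoeff q μ m ≠ 0) : F (e 0) = 0 := by
  obtain ⟨c, hc, -⟩ := he.exists_F_zero h hQ hud
  have h1 : ∀ k ≤ u, ∃ p : ℂ, p ≠ 0 ∧ (F ^ k) ((E ^ k) (e 0)) = p • e 0 := by
    intro k hk
    induction k with
    | zero => exact ⟨1, one_ne_zero, by simp⟩
    | succ k ih =>
      obtain ⟨p, hp, hpk⟩ := ih (by omega)
      refine ⟨lowerCoeff q μ (k + 1) * p, mul_ne_zero (ha _ (by omega) hk) hp, ?_⟩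
      rw [pow_succ, Module.End.mul_apply, he.F_succ h hQ hud, map_smul, hpk, smul_smul]
  obtain ⟨p, hp, hpu⟩ := h1 u le_rfl
  have h2 : (F ^ (u + 1)) (e (Fin.last u)) = (p * c) • e (Fin.last u) := by
    rw [end_pow_succ_apply, he.last_eq, hpu, map_smul, hc, smul_smul, he.last_eq]
  have h3 := pow_apply_of_weight h2 d
  rw [← pow_mul, mul_comm, pow_mul, h.F_pow, zero_pow (Nat.succ_ne_zero u),
    LinearMap.zero_apply] at h3
  have h4 := pow_eq_zero_iff (NeZero.ne d) |>.mp
    ((smul_eq_zero.mp h3.symm).resolve_right (e.ne_zero _))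
  rw [hc, (mul_eq_zero.mp h4).resolve_left hp, zero_smul]

/-- If no structure constant vanishes, then `F` leads from the socle to the whole space. -/
theorem eq_top_of_stable [NeZero d] (he : IsStringBasis E K μ e) (h : IsUqTriple q d E F K)
    (hQ : IsPrimitiveRoot (q ^ 2) d) (hud : u < d)
    (ha : ∀ m, 1 ≤ m → m ≤ u → lowerCoeff q μ m ≠ 0) {W : Submodule ℂ V}
    (hWE : ∀ x ∈ W, E x ∈ W) (hWF : ∀ x ∈ W, F x ∈ W) (hW0 : W ≠ ⊥) : W = ⊤ := by
  have hlast := he.last_mem hWE hW0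
  rw [he.last_eq] at hlast
  have h1 : ∀ k ≤ u, (E ^ (u - k)) (e 0) ∈ W := by
    intro k hk
    induction k with
    | zero => simpa using hlast
    | succ k ih =>
      have h2 := hWF _ (ih (by omega))
      rw [show u - k = u - (k + 1) + 1 by omega, he.F_succ h hQ hud] at h2
      exact (W.smul_mem_iff (ha _ (by omega) (by omega))).mp h2
  rw [eq_top_iff, ← e.span_eq, Submodule.span_le]
  rintro _ ⟨j, rfl⟩
  rw [he.apply_eq j]
  have := h1 (u - j) (by omega)
  rwa [show u - (u - (j : ℕ)) = j by omega] at this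

/-- Construction of `F` on a string basis, from its value `c • e (Fin.last u)` on the first vector.
The hypothesis `hc` makes it nilpotent. -/
theorem exists_isUqTriple [NeZero d] (he : IsStringBasis E K μ e) (h : IsBorelPair (q ^ 2) d E K)
    (hQ : IsPrimitiveRoot (q ^ 2) d) (hud : u < d) (hu : lowerCoeff q μ (u + 1) = 0) (c : ℂ)
    (hc : c = 0 ∨ u + 1 = d ∧ ∃ m, 1 ≤ m ∧ m ≤ u ∧ lowerCoeff q μ m = 0) :
    ∃ F : Module.End ℂ V, IsUqTriple q d E F K ∧ F (e 0) = c • e (Fin.last u) := by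
  have hQ0 : q ^ 2 ≠ 0 := hQ.ne_zero (NeZero.ne d)
  have hμ := he.weight_ne_zero h
  have hμd := h.weight_pow_eq_one he.weight (e.ne_zero 0)
  let F : Module.End ℂ V := e.constr ℂ fun j : Fin (u + 1) =>
    if (j : ℕ) = 0 then c • e (Fin.last u) else lowerCoeff q μ j • (E ^ ((j : ℕ) - 1)) (e 0)
  have hF0 : F (e 0) = c • e (Fin.last u) := (e.constr_basis ℂ _ 0).trans (by simp)
  have hF1 : ∀ j, F ((E ^ (j + 1)) (e 0)) = lowerCoeff q μ (j + 1) • (E ^ j) (e 0) := by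
    intro j
    rcases lt_trichotomy j u with hj | rfl | hj
    · have h1 := he.apply_eq ⟨j + 1, by omega⟩
      simp only at h1
      rw [← h1, Module.Basis.constr_basis]
      simp
    · rw [he.pow_succ_eq_zero, hu, map_zero, zero_smul]
    · rw [he.pow_eq_zero hj, he.pow_eq_zero (by omega : u < j + 1), map_zero, smul_zero]
  refine ⟨F, ⟨h, ?_, ?_, ?_⟩, hF0⟩
  · -- the string, read downwards and cyclically, is cut at the index `m`
    obtain ⟨m, hmu, hm⟩ : ∃ m ≤ u, F ((E ^ m) (e 0)) = 0 := by
      rcases hc with rfl | ⟨-, m, hm1, hmu, hm⟩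
      · exact ⟨0, Nat.zero_le u, by simpa using hF0⟩
      · refine ⟨m, hmu, ?_⟩
        obtain ⟨k, rfl⟩ := Nat.exists_eq_add_of_le' hm1
        rw [hF1, hm, zero_smul]
    have hA : ∀ k, (F ^ (k + 1)) ((E ^ (m + k)) (e 0)) = 0 := by
      intro k
      induction k with
      | zero => simpa using hm
      | succ k ih =>
        rw [pow_succ, Module.End.mul_apply, ← add_assoc, hF1, map_smul, ih, smul_zero]
    have hB : ∀ k, ∃ p : ℂ, (F ^ k) ((E ^ k) (e 0)) = p • e 0 := by
      intro k
      induction k with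
      | zero => exact ⟨1, by simp⟩
      | succ k ih =>
        obtain ⟨p, hp⟩ := ih
        exact ⟨_, by rw [pow_succ, Module.End.mul_apply, hF1, map_smul, hp, smul_smul]⟩
    refine he.linearMap_ext fun j => ?_
    rw [LinearMap.zero_apply]
    rcases Nat.lt_or_ge u j with hj | hj
    · rw [he.pow_eq_zero hj, map_zero]
    rcases le_or_gt m j with hmj | hmj
    · obtain ⟨k, rfl⟩ := Nat.exists_eq_add_of_le hmj
      exact Module.End.pow_map_zero_of_le (by omega) (hA k)
    · obtain ⟨p, hp⟩ := hB j
      have h2 := hA (u - m)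
      rw [Nat.add_sub_cancel' hmu, ← he.last_eq] at h2
      have h3 : (F ^ (u - m + 1 + (j + 1))) ((E ^ j) (e 0)) = 0 := by
        rw [pow_add, Module.End.mul_apply, end_pow_succ_apply F j, hp, map_smul, hF0, map_smul,
          map_smul, h2, smul_zero, smul_zero]
      exact Module.End.pow_map_zero_of_le (by omega) h3
  · refine he.linearMap_ext fun j => ?_
    rw [LinearMap.smul_apply, Module.End.mul_apply, Module.End.mul_apply, h.weight_E_pow he.weight,
      map_smul]
    cases j with
    | zero =>
      simp only [pow_zero, Module.End.one_apply, mul_one]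
      rw [hF0, map_smul, he.last_eq, h.weight_E_pow he.weight]
      rcases hc with rfl | ⟨hd, -⟩
      · simp
      · have h1 : (q ^ 2)⁻¹ = (q ^ 2) ^ u := by
          symm
          apply eq_inv_of_mul_eq_one_left
          rw [← pow_succ, hd, hQ.pow_eq_one]
        rw [h1, smul_smul, smul_smul, smul_smul]
        ring_nf
    | succ j =>
      rw [hF1, map_smul, h.weight_E_pow he.weight, smul_smul, smul_smul, smul_smul]
      congr 1
      rw [pow_succ (q ^ 2) j]
      generalize q ^ 2 = Q at *
      field_simp
  · refine he.linearMap_ext fun j => ?_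
    have hw := h.weight_E_pow he.weight j
    have hinv : (μ * (q ^ 2) ^ j) ^ (d - 1) = (μ * (q ^ 2) ^ j)⁻¹ := by
      apply eq_inv_of_mul_eq_one_left
      rw [← pow_succ, Nat.sub_add_cancel (NeZero.pos d), mul_pow, hμd, ← pow_mul, mul_comm j,
        pow_mul, hQ.pow_eq_one, one_pow, one_mul]
    have h1 : E (F ((E ^ j) (e 0))) = lowerCoeff q μ j • (E ^ j) (e 0) := by
      cases j with
      | zero => simp [hF0, he.E_last]
      | succ j => rw [hF1, map_smul, ← end_pow_succ_apply]
    rw [LinearMap.sub_apply, Module.End.mul_apply, Module.End.mul_apply, h1, ← end_pow_succ_apply,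
      hF1, LinearMap.smul_apply, LinearMap.sub_apply, pow_apply_of_weight hw, hw, hinv,
      lowerCoeff_succ, ← sub_smul, ← sub_smul, smul_smul]
    congr 1
    ring

end IsStringBasis

end Uq

/-! ### Weight projections -/

namespace Uq

variable {V : Type v} [AddCommGroup V] [Module ℂ V] {q Q μ : ℂ} {d u : ℕ}
  {E F K : Module.End ℂ V}

/-- The projection to the eigenspace of `K` for the eigenvalue `μ`, if `K ^ d = 1` and
`μ ^ d = 1`. -/
noncomputable def weightProj (K : Module.End ℂ V) (d : ℕ) (μ : ℂ) : Module.End ℂ V :=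
  (d : ℂ)⁻¹ • ∑ l ∈ Finset.range d, (μ⁻¹) ^ l • K ^ l

theorem K_mul_weightProj [NeZero d] (hK : K ^ d = 1) (hμ : μ ^ d = 1) :
    K * weightProj K d μ = μ • weightProj K d μ := by
  have hμ0 : μ ≠ 0 := by
    rintro rfl
    simp [NeZero.ne d] at hμ
  rw [weightProj, mul_smul_comm, smul_comm μ]
  congr 1
  have h1 : ∑ l ∈ Finset.range d, (μ⁻¹) ^ (l + 1) • K ^ (l + 1) =
      ∑ l ∈ Finset.range d, (μ⁻¹) ^ l • K ^ l := by
    have h2 := Finset.sum_range_succ (fun l => (μ⁻¹) ^ l • K ^ l) d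
    rw [Finset.sum_range_succ', inv_pow _ d, hμ, hK] at h2
    simpa using h2
  conv_rhs => rw [← h1]
  rw [Finset.mul_sum, Finset.smul_sum]
  refine Finset.sum_congr rfl fun l _ => ?_
  rw [mul_smul_comm, smul_smul, pow_succ' (μ⁻¹), ← mul_assoc, mul_inv_cancel₀ hμ0, one_mul,
    pow_succ' K]

theorem weightProj_mul_K : weightProj K d μ * K = K * weightProj K d μ := by
  rw [weightProj, mul_smul_comm, smul_mul_assoc, Finset.mul_sum, Finset.sum_mul]
  congr 1
  refine Finset.sum_congr rfl fun l _ => ?_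
  rw [mul_smul_comm, smul_mul_assoc, ← pow_succ, ← pow_succ']

theorem weightProj_apply_of_weight [NeZero d] (hμ0 : μ ≠ 0) {x : V} (hx : K x = μ • x) :
    weightProj K d μ x = x := by
  have h1 : ∀ l, ((μ⁻¹) ^ l • K ^ l) x = x := by
    intro l
    rw [LinearMap.smul_apply, pow_apply_of_weight hx, smul_smul, ← mul_pow, inv_mul_cancel₀ hμ0,
      one_pow, one_smul]
  have hd : (d : ℂ) ≠ 0 := Nat.cast_ne_zero.mpr (NeZero.ne d)
  rw [weightProj, LinearMap.smul_apply, LinearMap.sum_apply, Finset.sum_congr rfl fun l _ => h1 l,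
    Finset.sum_const, Finset.card_range, ← Nat.cast_smul_eq_nsmul ℂ, smul_smul,
    inv_mul_cancel₀ hd, one_smul]

theorem sum_weightProj [NeZero d] (hQ : IsPrimitiveRoot Q d) :
    ∑ w ∈ Finset.range d, weightProj K d (Q ^ w) = 1 := by
  have hd : (d : ℂ) ≠ 0 := Nat.cast_ne_zero.mpr (NeZero.ne d)
  simp only [weightProj]
  rw [← Finset.smul_sum, Finset.sum_comm]
  have h1 : ∀ l ∈ Finset.range d, ∑ w ∈ Finset.range d, ((Q ^ w)⁻¹) ^ l • K ^ l =
      if l = 0 then (d : ℂ) • 1 else 0 := by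
    intro l hl
    rw [← Finset.sum_smul]
    split_ifs with hl0
    · simp [hl0]
    · have h2 : ∀ w ∈ Finset.range d, ((Q ^ w)⁻¹) ^ l = ((Q ^ l)⁻¹) ^ w := by
        intro w _
        rw [inv_pow, inv_pow, ← pow_mul, ← pow_mul, mul_comm]
      have h3 : (Q ^ l)⁻¹ - 1 ≠ 0 := by
        rw [sub_ne_zero, Ne, inv_eq_one, hQ.pow_eq_one_iff_dvd]
        intro h
        exact absurd (Nat.le_of_dvd (Nat.pos_of_ne_zero hl0) h)
          (not_le.mpr (Finset.mem_range.mp hl))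
      have h4 := geom_sum_mul ((Q ^ l)⁻¹) d
      rw [inv_pow (Q ^ l) d, ← pow_mul, mul_comm l, pow_mul, hQ.pow_eq_one, one_pow, inv_one,
        sub_self] at h4
      rw [Finset.sum_congr rfl h2, (mul_eq_zero.mp h4).resolve_right h3, zero_smul]
  rw [Finset.sum_congr rfl h1, Finset.sum_ite_eq' (Finset.range d) 0,
    if_pos (Finset.mem_range.mpr (NeZero.pos d)), smul_smul, inv_mul_cancel₀ hd, one_smul]

/-- A nonzero linear map does not vanish on all weight vectors. -/
theorem exists_weight_vector [NeZero d] (hQ : IsPrimitiveRoot Q d) (hK : K ^ d = 1)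
    {T : Module.End ℂ V} (hT : T ≠ 0) : ∃ w < d, ∃ x, K x = Q ^ w • x ∧ T x ≠ 0 := by
  by_contra! hcon
  refine hT (LinearMap.ext fun x => ?_)
  have h1 : x = ∑ w ∈ Finset.range d, weightProj K d (Q ^ w) x := by
    rw [← LinearMap.sum_apply, sum_weightProj hQ, Module.End.one_apply]
  rw [h1, map_sum, LinearMap.zero_apply]
  refine Finset.sum_eq_zero fun w hw => hcon w (Finset.mem_range.mp hw) _ ?_
  have hμ : (Q ^ w) ^ d = 1 := by rw [← pow_mul, mul_comm, pow_mul, hQ.pow_eq_one, one_pow]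
  rw [← Module.End.mul_apply, K_mul_weightProj hK hμ, LinearMap.smul_apply]

/-- A weight vector has a dual weight functional. -/
theorem exists_weight_functional [NeZero d] (hK : K ^ d = 1) (hμ : μ ^ d = 1) {x : V}
    (hx : K x = μ • x) (hx0 : x ≠ 0) :
    ∃ φ : Module.Dual ℂ V, φ x = 1 ∧ ∀ y, φ (K y) = μ * φ y := by
  have hμ0 : μ ≠ 0 := by
    rintro rfl
    simp [NeZero.ne d] at hμ
  obtain ⟨ψ, hψ⟩ : ∃ ψ : Module.Dual ℂ V, ψ x ≠ 0 := by
    by_contra! hcon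
    exact hx0 ((Module.forall_dual_apply_eq_zero_iff ℂ x).mp hcon)
  refine ⟨(ψ x)⁻¹ • ψ ∘ₗ weightProj K d μ, ?_, fun y => ?_⟩
  · rw [LinearMap.smul_apply, LinearMap.comp_apply, weightProj_apply_of_weight hμ0 hx, smul_eq_mul,
      inv_mul_cancel₀ hψ]
  · rw [LinearMap.smul_apply, LinearMap.smul_apply, LinearMap.comp_apply, LinearMap.comp_apply,
      ← Module.End.mul_apply, weightProj_mul_K, K_mul_weightProj hK hμ, LinearMap.smul_apply,
      map_smul, smul_eq_mul, smul_eq_mul, smul_eq_mul]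
    ring

/-! ### Splitting off a string of maximal length -/

theorem IsBorelPair.K_E_pow (h : IsBorelPair Q d E K) (j : ℕ) (x : V) :
    K ((E ^ j) x) = Q ^ j • (E ^ j) (K x) := by
  induction j with
  | zero => simp
  | succ j ih =>
    rw [end_pow_succ_apply, ← Module.End.mul_apply, h.K_mul_E, LinearMap.smul_apply,
      Module.End.mul_apply, ih, map_smul, smul_smul, pow_succ', end_pow_succ_apply]

/-- If `Eᵘ⁺¹ = 0` and `x` is a weight vector with `Eᵘ x ≠ 0`, then the span of the string of `x` is
a direct summand: the matrix coefficients `φ (Eᵘ⁻ʲ m)`, for a weight functional `φ` with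
`φ (Eᵘ x) = 1`, are the coordinates of an equivariant projection. -/
theorem IsBorelPair.exists_string_projection [NeZero d] (h : IsBorelPair Q d E K)
    (hQ : IsPrimitiveRoot Q d) (hud : u < d) (hE : E ^ (u + 1) = 0) {x : V} (hx : K x = μ • x)
    (hxu : (E ^ u) x ≠ 0) :
    ∃ π : Module.End ℂ V, (∀ m, π (E m) = E (π m)) ∧ (∀ m, π (K m) = K (π m)) ∧ π x = x ∧
      ∀ m, π m ∈ Submodule.span ℂ (Set.range fun j : Fin (u + 1) => (E ^ (j : ℕ)) x) := by
  have hQ0 : Q ≠ 0 := hQ.ne_zero (NeZero.ne d)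
  have hx0 : x ≠ 0 := by
    rintro rfl
    simp at hxu
  have hμ0 : μ ≠ 0 := by
    rintro rfl
    have := h.weight_pow_eq_one hx hx0
    simp [NeZero.ne d] at this
  have hwu := h.weight_E_pow hx u
  obtain ⟨φ, hφ1, hφK⟩ := exists_weight_functional h.K_pow (h.weight_pow_eq_one hwu hxu) hwu hxu
  have hφ0 : ∀ j < u, φ ((E ^ j) x) = 0 := by
    intro j hj
    have h1 := hφK ((E ^ j) x)
    rw [h.weight_E_pow hx, map_smul, smul_eq_mul, ← sub_eq_zero, ← sub_mul] at h1
    refine (mul_eq_zero.mp h1).resolve_left (sub_ne_zero.mpr fun h2 => ?_)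
    exact hj.ne (hQ.pow_inj (by omega) hud (mul_left_cancel₀ hμ0 h2))
  let π : Module.End ℂ V :=
    ∑ j ∈ Finset.range (u + 1), (φ ∘ₗ E ^ (u - j)).smulRight ((E ^ j) x)
  have hπ : ∀ m, π m = ∑ j ∈ Finset.range (u + 1), φ ((E ^ (u - j)) m) • (E ^ j) x := by
    intro m
    simp [π, LinearMap.sum_apply]
  have hEu : ∀ m, (E ^ (u + 1)) m = 0 := fun m => by rw [hE, LinearMap.zero_apply]
  refine ⟨π, fun m => ?_, fun m => ?_, ?_, fun m => ?_⟩
  · rw [hπ, hπ, map_sum, Finset.sum_range_succ', Finset.sum_range_succ]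
    have h1 : (E ^ (u - 0)) (E m) = 0 := by
      rw [Nat.sub_zero, ← Module.End.mul_apply, ← pow_succ, hEu]
    have h2 : E ((E ^ u) x) = 0 := by rw [← end_pow_succ_apply, hEu]
    rw [h1, map_zero, zero_smul, map_smul, h2, smul_zero, add_zero, add_zero]
    refine Finset.sum_congr rfl fun j hj => ?_
    rw [map_smul, ← end_pow_succ_apply, ← Module.End.mul_apply, ← pow_succ,
      show u - (j + 1) + 1 = u - j by have := Finset.mem_range.mp hj; omega]
  · rw [hπ, hπ, map_sum]
    refine Finset.sum_congr rfl fun j hj => ?_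
    have hj' := Finset.mem_range.mp hj
    rw [map_smul, h.weight_E_pow hx, smul_smul]
    congr 1
    have h1 := hφK ((E ^ (u - j)) m)
    rw [h.K_E_pow, map_smul, smul_eq_mul] at h1
    refine mul_left_cancel₀ (pow_ne_zero (u - j) hQ0) ?_
    rw [h1, show Q ^ u = Q ^ (u - j) * Q ^ j by rw [← pow_add, Nat.sub_add_cancel (by omega)]]
    ring
  · rw [hπ, Finset.sum_range_succ', Finset.sum_eq_zero, zero_add, Nat.sub_zero, hφ1, one_smul,
      pow_zero, Module.End.one_apply]
    intro j hj
    rw [hφ0 _ (by have := Finset.mem_range.mp hj; omega), zero_smul]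
  · rw [hπ]
    refine Submodule.sum_mem _ fun j hj => Submodule.smul_mem _ _ (Submodule.subset_span ?_)
    exact ⟨⟨j, Finset.mem_range.mp hj⟩, rfl⟩

/-- A weight vector whose string spans the space gives a string basis. -/
theorem IsBorelPair.exists_isStringBasis [NeZero d] (h : IsBorelPair Q d E K)
    (hQ : IsPrimitiveRoot Q d) (hud : u < d) {x : V} (hx : K x = μ • x) (hxu : (E ^ u) x ≠ 0)
    (hxu1 : (E ^ (u + 1)) x = 0)
    (hspan : ⊤ ≤ Submodule.span ℂ (Set.range fun j : Fin (u + 1) => (E ^ (j : ℕ)) x)) :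
    ∃ e : Module.Basis (Fin (u + 1)) ℂ V, e 0 = x ∧ IsStringBasis E K μ e := by
  refine ⟨Module.Basis.mk (linearIndependent_string hQ h hud hx hxu) hspan, ?_, ?_⟩
  · simp
  · exact ⟨by simp, by simpa using hx, by simpa using hxu1⟩

end Uq

/-! ### Modules over `u_q⁺` -/

namespace Uq

section PlusModule

variable {q : ℂ} {d u : ℕ} {M : Type v} [AddCommGroup M] [Module ℂ M] [Module (plus q d) M]
  [IsScalarTower ℂ (plus q d) M]

theorem isStandardBasis_iff {i : ZMod d} {e : Module.Basis (Fin (u + 1)) ℂ M} :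
    IsStandardBasis q d i u e ↔
      IsStringBasis (endE q d M) (endK q d M) ((q ^ 2) ^ i.val) e := by
  constructor
  · intro h
    have hap : ∀ j, e j = (endE q d M ^ (j : ℕ)) (e 0) := by
      intro j
      induction j using Fin.induction with
      | zero => simp
      | succ j ih =>
        rw [Fin.val_succ, end_pow_succ_apply, ← Fin.val_castSucc, ← ih, endE_apply, h.E_smul]
    refine ⟨hap, ?_, ?_⟩
    · rw [endK_apply, h.K_smul, Fin.val_zero, add_zero, pow_mul]
    · have h1 := hap (Fin.last u)
      rw [Fin.val_last] at h1
      rw [end_pow_succ_apply, ← h1, endE_apply, h.E_smul_last]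
  · intro h
    refine ⟨fun j => ?_, fun j => ?_, ?_⟩
    · rw [h.apply_eq j, ← endK_apply, (isBorelPair_end q d M).weight_E_pow h.weight, ← pow_add,
        ← pow_mul]
    · rw [h.apply_eq j.succ, h.apply_eq j.castSucc, Fin.val_succ, Fin.val_castSucc,
        end_pow_succ_apply, endE_apply]
    · exact h.E_last


/-- The modules `M_i^u` have a simple socle. -/
theorem IsStringBasis.isIndecomposable {μ : ℂ} {e : Module.Basis (Fin (u + 1)) ℂ M}
    (he : IsStringBasis (endE q d M) (endK q d M) μ e) : IsIndecomposable (plus q d) M := by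
  refine ⟨⟨⟨e 0, 0, e.ne_zero 0⟩⟩, fun A B hAB => ?_⟩
  by_contra! hcon
  have key : ∀ A : Submodule (plus q d) M, A ≠ ⊥ → e (Fin.last u) ∈ A := fun A hA =>
    he.last_mem (W := A.restrictScalars ℂ) (fun x hx => A.smul_mem (plusE q d) hx)
      (fun h => hA ((Submodule.restrictScalars_eq_bot_iff ℂ (plus q d) M).mp h))
  exact e.ne_zero (Fin.last u)
    (Submodule.disjoint_def.mp hAB.disjoint _ (key A hcon.1) (key B hcon.2))

/-- The half-quantum group is a Nakayama algebra: its indecomposable modules are the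
`M_i^u` with `u < d`. -/
theorem IsIndecomposable.exists_isStringBasis [NeZero d] (hQ : IsPrimitiveRoot (q ^ 2) d)
    (hM : IsIndecomposable (plus q d) M) :
    ∃ (i : ZMod d) (u : ℕ) (_ : u < d) (e : Module.Basis (Fin (u + 1)) ℂ M),
      IsStringBasis (endE q d M) (endK q d M) ((q ^ 2) ^ i.val) e := by
  classical
  have h := isBorelPair_end q d M
  obtain ⟨hnt, hM⟩ := hM
  have hex : ∃ k, endE q d M ^ k = 0 := ⟨d, h.E_pow⟩
  obtain ⟨u, hu⟩ : ∃ u, Nat.find hex = u + 1 := by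
    refine Nat.exists_eq_succ_of_ne_zero fun h0 => ?_
    have h1 := (Nat.find_eq_zero hex).mp h0
    rw [pow_zero] at h1
    exact one_ne_zero h1
  have hE : endE q d M ^ (u + 1) = 0 := hu ▸ Nat.find_spec hex
  have hEu : endE q d M ^ u ≠ 0 := Nat.find_min hex (by omega)
  have hud : u < d := by
    have := Nat.find_min' hex h.E_pow
    omega
  obtain ⟨w, hw, x, hx, hxu⟩ := exists_weight_vector hQ h.K_pow hEu
  obtain ⟨π, hπE, hπK, hπx, hπs⟩ := h.exists_string_projection hQ hud hE hx hxu
  have hπpow : ∀ j, π ((endE q d M ^ j) x) = (endE q d M ^ j) x := by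
    intro j
    induction j with
    | zero => simpa using hπx
    | succ j ih => rw [end_pow_succ_apply, hπE, ih]
  have hπid : ∀ y ∈ Submodule.span ℂ (Set.range fun j : Fin (u + 1) => (endE q d M ^ (j : ℕ)) x),
      π y = y := by
    intro y hy
    induction hy using Submodule.span_induction with
    | mem y hy => obtain ⟨j, rfl⟩ := hy; exact hπpow j
    | zero => exact map_zero π
    | add y z _ _ hy hz => rw [map_add, hy, hz]
    | smul c y _ hy => rw [map_smul, hy]
  let p : M →ₗ[plus q d] M :=
    { toFun := π
      map_add' := map_add π
      map_smul' := map_plus_smul hπE hπK }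
  have hp : IsIdempotentElem p := LinearMap.ext fun m => hπid _ (hπs m)
  have hx0 : x ≠ 0 := by
    rintro rfl
    simp at hxu
  have hker : LinearMap.ker p = ⊥ := by
    have hc := LinearMap.IsIdempotentElem.isCompl (R := plus q d) (E := M) (f := p) hp
    refine (hM _ _ hc).resolve_left fun hr => hx0 ?_
    have h1 : p x ∈ LinearMap.range p := ⟨x, rfl⟩
    rw [hr, Submodule.mem_bot] at h1
    exact hπx.symm.trans h1
  have hid : ∀ m, π m = m := by
    intro m
    have h1 : π (m - π m) = 0 := by rw [map_sub, hπid _ (hπs m), sub_self]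
    have h2 : m - π m ∈ LinearMap.ker p := h1
    rw [hker, Submodule.mem_bot, sub_eq_zero] at h2
    exact h2.symm
  obtain ⟨e, -, he⟩ := h.exists_isStringBasis hQ hud hx hxu (by rw [hE, LinearMap.zero_apply])
    (fun m _ => hid m ▸ hπs m)
  refine ⟨(w : ZMod d), u, hud, e, ?_⟩
  rwa [ZMod.val_natCast_of_lt hw]

/-- Extensions with a prescribed value of `F` on the first vector of a string basis. -/
theorem IsStringBasis.exists_extension [NeZero d] {μ : ℂ} {e : Module.Basis (Fin (u + 1)) ℂ M}
    (he : IsStringBasis (endE q d M) (endK q d M) μ e) (hQ : IsPrimitiveRoot (q ^ 2) d)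
    (hud : u < d) (hu : lowerCoeff q μ (u + 1) = 0) (c : ℂ)
    (hc : c = 0 ∨ u + 1 = d ∧ ∃ m, 1 ≤ m ∧ m ≤ u ∧ lowerCoeff q μ m = 0) :
    ∃ X : Extension q d M, X.act (gen q d UqGen.F) (e 0) = c • e (Fin.last u) := by
  obtain ⟨F, hF, hF0⟩ := he.exists_isUqTriple (isBorelPair_end q d M) hQ hud hu c hc
  obtain ⟨X, rfl⟩ := Uq.exists_extension hF
  exact ⟨X, hF0⟩

theorem IsStringBasis.extension_eq [NeZero d] {μ : ℂ} {e : Module.Basis (Fin (u + 1)) ℂ M}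
    (he : IsStringBasis (endE q d M) (endK q d M) μ e) (hQ : IsPrimitiveRoot (q ^ 2) d)
    (hud : u < d) {X Y : Extension q d M}
    (h : X.act (gen q d UqGen.F) (e 0) = Y.act (gen q d UqGen.F) (e 0)) : X = Y :=
  Extension.eq_of_act_F_eq (he.F_unique X.isUqTriple Y.isUqTriple hQ hud h)

/-- Isomorphic extensions of `M_i^u` are equal, because the endomorphisms of `M_i^u` are scalars. -/
theorem IsStringBasis.extension_eq_of_iso [NeZero d] {μ : ℂ}
    {e : Module.Basis (Fin (u + 1)) ℂ M} (he : IsStringBasis (endE q d M) (endK q d M) μ e)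
    (hQ : IsPrimitiveRoot (q ^ 2) d) (hud : u < d) {X Y : Extension q d M} (h : X.Iso Y) :
    X = Y := by
  obtain ⟨f⟩ := h
  have hf : ∀ (a : Uq q d) (m : M), (f (X.act a m : M) : M) = Y.act a (f m : M) :=
    fun a m => f.map_smul a (m : X.Carrier)
  let g : Module.End ℂ M :=
    { toFun := fun m => f m
      map_add' := fun a b => f.map_add a b
      map_smul' := fun c m => by
        have h1 := hf (algebraMap ℂ _ c) m
        rw [AlgHom.commutes, AlgHom.commutes] at h1
        exact h1 }
  have hg : ∀ (a : Uq q d) (m : M), g (X.act a m) = Y.act a (g m) := hf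
  have hgi : ∀ m, g m = 0 → m = 0 := fun m hm => f.injective (hm.trans f.map_zero.symm)
  obtain ⟨c, hc⟩ := he.eq_smul_of_commute (f := g) (isBorelPair_end q d M) hQ hud
    (fun x => by rw [← X.act_E, hg, X.act_E, Y.act_E])
    (fun x => by rw [← X.act_K, hg, X.act_K, Y.act_K])
  have hc0 : c ≠ 0 := by
    rintro rfl
    exact e.ne_zero 0 (hgi _ (by rw [hc, zero_smul]))
  refine Extension.eq_of_act_F_eq (LinearMap.ext fun m => ?_)
  have h1 := hg (gen q d UqGen.F) m
  rw [hc, hc, map_smul] at h1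
  exact smul_right_injective M hc0 h1

/-- If no structure constant vanishes on a string basis, every extension is simple. -/
theorem IsStringBasis.isSimpleModule [NeZero d] {μ : ℂ} {e : Module.Basis (Fin (u + 1)) ℂ M}
    (he : IsStringBasis (endE q d M) (endK q d M) μ e) (hQ : IsPrimitiveRoot (q ^ 2) d)
    (hud : u < d) (ha : ∀ m, 1 ≤ m → m ≤ u → lowerCoeff q μ m ≠ 0) (X : Extension q d M) :
    IsSimpleModule (Uq q d) X.Carrier := by
  have : Nontrivial (Submodule (Uq q d) X.Carrier) :=
    (Submodule.nontrivial_iff (Uq q d)).mpr ⟨⟨(e 0 : M), (0 : M), e.ne_zero 0⟩⟩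
  refine { eq_bot_or_eq_top := fun N => ?_ }
  let W : Submodule ℂ M :=
    { carrier := {m : M | (m : X.Carrier) ∈ N}
      add_mem' := fun {a b} ha hb => N.add_mem ha hb
      zero_mem' := N.zero_mem
      smul_mem' := fun c m hm => by
        have h1 : X.act (algebraMap ℂ _ c) m = c • m := by rw [AlgHom.commutes]; rfl
        rw [← h1]
        exact N.smul_mem (algebraMap ℂ _ c) hm }
  have hW : ∀ (a : Uq q d), ∀ m ∈ W, X.act a m ∈ W := fun a m hm => N.smul_mem a hm
  rcases eq_or_ne W ⊥ with h0 | h0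
  · left
    refine (Submodule.eq_bot_iff N).mpr fun m hm => ?_
    have h1 : (m : M) ∈ W := hm
    rw [h0] at h1
    exact h1
  · right
    have h1 := he.eq_top_of_stable X.isUqTriple hQ hud ha
      (fun m hm => X.act_E ▸ hW _ m hm) (hW _) h0
    refine eq_top_iff.mpr fun m _ => ?_
    have h2 : ∀ m : M, m ∈ W := fun m => h1 ▸ Submodule.mem_top
    exact h2 m

end PlusModule

/-- An extendable module `M_i^u` exists as soon as `a_{u+1} = 0`. -/
theorem exists_isTypeM {q : ℂ} {d : ℕ} [NeZero d] (hQ : IsPrimitiveRoot (q ^ 2) d) (i : ZMod d)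
    {u : ℕ} (hud : u < d) (hu : lowerCoeff q ((q ^ 2) ^ i.val) (u + 1) = 0) :
    ∃ (M : Type v) (_ : AddCommGroup M) (_ : Module ℂ M) (_ : Module (plus q d) M)
      (_ : IsScalarTower ℂ (plus q d) M), IsTypeM q d i u M := by
  let V : Type v := ULift.{v} (Fin (u + 1) → ℂ)
  let e : Module.Basis (Fin (u + 1)) ℂ V := (Pi.basisFun ℂ (Fin (u + 1))).map ULift.moduleEquiv.symm
  let E : Module.End ℂ V :=
    e.constr ℂ fun j => if h : (j : ℕ) + 1 < u + 1 then e ⟨j + 1, h⟩ else 0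
  let K : Module.End ℂ V :=
    e.constr ℂ fun j => ((q ^ 2) ^ i.val * (q ^ 2) ^ (j : ℕ)) • e j
  have hE : ∀ j, E (e j) = if h : (j : ℕ) + 1 < u + 1 then e ⟨j + 1, h⟩ else 0 := fun j =>
    e.constr_basis ℂ _ j
  have hK : ∀ j, K (e j) = ((q ^ 2) ^ i.val * (q ^ 2) ^ (j : ℕ)) • e j := fun j =>
    e.constr_basis ℂ _ j
  have hEpow : ∀ j (hj : j < u + 1), e ⟨j, hj⟩ = (E ^ j) (e 0) := by
    intro j
    induction j with
    | zero => intro _; rfl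
    | succ j ih =>
      intro hj
      rw [end_pow_succ_apply, ← ih (by omega), hE, dif_pos hj]
  have he : IsStringBasis E K ((q ^ 2) ^ i.val) e := by
    refine ⟨fun j => hEpow j j.2, ?_, ?_⟩
    · rw [hK, Fin.val_zero, pow_zero, mul_one]
    · rw [end_pow_succ_apply, ← hEpow u (by omega), hE, dif_neg (by simp)]
  have h : IsBorelPair (q ^ 2) d E K := by
    refine ⟨?_, ?_, ?_⟩
    · refine he.linearMap_ext fun j => ?_
      rw [← Module.End.mul_apply, ← pow_add, he.pow_eq_zero (by omega), LinearMap.zero_apply]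
    · refine e.ext fun j => ?_
      rw [pow_apply_of_weight (hK j), ← pow_add, ← pow_mul, mul_comm _ d, pow_mul, hQ.pow_eq_one,
        one_pow, one_smul, Module.End.one_apply]
    · refine e.ext fun j => ?_
      rw [LinearMap.smul_apply, Module.End.mul_apply, Module.End.mul_apply, hK, map_smul, hE]
      split_ifs with hj
      · rw [hK, smul_smul, pow_succ']
        ring_nf
      · simp
  obtain ⟨F, hF, -⟩ := he.exists_isUqTriple h hQ hud hu 0 (Or.inl rfl)
  obtain ⟨ρ, hρE, -, hρK⟩ := hF.exists_algHom
  let _ : Module (plus q d) V := Module.compHom V (ρ.comp (plus q d).val).toRingHom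
  have hsmul : ∀ (a : plus q d) (x : V), a • x = ρ a x := fun _ _ => rfl
  have : IsScalarTower ℂ (plus q d) V := ⟨fun c a x => by
    rw [hsmul, hsmul, Subalgebra.coe_smul, map_smul, LinearMap.smul_apply]⟩
  refine ⟨V, inferInstance, inferInstance, inferInstance, inferInstance, e,
    isStandardBasis_iff.mpr ?_⟩
  rwa [show endE q d V = E from hρE, show endK q d V = K from hρK]

/-! ### Simple modules over `u_q` -/

section Simple

variable {q : ℂ} {d : ℕ} {S : Type v} [AddCommGroup S] [Module ℂ S] [Module (Uq q d) S]
  [IsScalarTower ℂ (Uq q d) S]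

/-- The action of `F` on a `u_q`-module. -/
noncomputable def endF (q : ℂ) (d : ℕ) (S : Type v) [AddCommGroup S] [Module ℂ S]
    [Module (Uq q d) S] [IsScalarTower ℂ (Uq q d) S] : Module.End ℂ S :=
  Algebra.lsmul ℂ ℂ S (gen q d UqGen.F)

variable (q d S) in
theorem isUqTriple_end : IsUqTriple q d (endE q d S) (endF q d S) (endK q d S) :=
  isUqTriple_of_algHom (Algebra.lsmul ℂ ℂ S)

/-- A lowest weight vector of a simple module generates it under the action of `E` alone. -/
theorem span_string_eq_top [NeZero d] [IsSimpleModule (Uq q d) S] {μ : ℂ} {x : S} (hx0 : x ≠ 0)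
    (hx : endK q d S x = μ • x) (hFx : endF q d S x = 0) :
    Submodule.span ℂ (Set.range fun j : ℕ => (endE q d S ^ j) x) = ⊤ := by
  have h := isUqTriple_end q d S
  set W := Submodule.span ℂ (Set.range fun j : ℕ => (endE q d S ^ j) x) with hWdef
  have hmem : ∀ j, (endE q d S ^ j) x ∈ W := fun j => Submodule.subset_span ⟨j, rfl⟩
  have hstab : ∀ T : Module.End ℂ S, (∀ j, T ((endE q d S ^ j) x) ∈ W) → ∀ y ∈ W, T y ∈ W := by
    intro T hT y hy
    induction hy using Submodule.span_induction with
    | mem y hy => obtain ⟨j, rfl⟩ := hy; exact hT j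
    | zero => rw [map_zero]; exact W.zero_mem
    | add y z _ _ hy hz => rw [map_add]; exact W.add_mem hy hz
    | smul c y _ hy => rw [map_smul]; exact W.smul_mem c hy
  have hgen : ∀ (g : UqGen), ∀ y ∈ W, gen q d g • y ∈ W := by
    rintro (_ | _ | _)
    · refine hstab (endE q d S) fun j => ?_
      rw [← end_pow_succ_apply]
      exact hmem _
    · refine hstab (endF q d S) fun j => ?_
      cases j with
      | zero =>
        rw [pow_zero, Module.End.one_apply, hFx]
        exact W.zero_mem
      | succ j =>
        rw [h.F_E_pow_succ (NeZero.pos d) hx (by rw [hFx, map_zero])]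
        exact W.smul_mem _ (hmem j)
    · refine hstab (endK q d S) fun j => ?_
      rw [h.weight_E_pow hx]
      exact W.smul_mem _ (hmem j)
  have hall : ∀ (a : Uq q d), ∀ y ∈ W, a • y ∈ W := by
    intro a
    induction a using gen_induction with
    | hgen g => exact hgen g
    | hC c => intro y hy; rw [algebraMap_smul]; exact W.smul_mem c hy
    | hadd a b ha hb => intro y hy; rw [add_smul]; exact W.add_mem (ha y hy) (hb y hy)
    | hmul a b ha hb => intro y hy; rw [mul_smul]; exact ha _ (hb y hy)
  let N : Submodule (Uq q d) S :=
    { W with smul_mem' := fun a y hy => hall a y hy }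
  have hxN : x ∈ N := hmem 0
  have hN : N = ⊤ := (eq_bot_or_eq_top N).resolve_left fun h0 => hx0 (by
    rw [h0] at hxN
    exact hxN)
  refine eq_top_iff.mpr fun y _ => ?_
  have : y ∈ N := hN ▸ Submodule.mem_top
  exact this

/-- A simple module has a string basis whose first vector is killed by `F`. The structure constants
do not vanish: otherwise a later vector of the string would generate a proper submodule. -/
theorem exists_isStringBasis_of_isSimpleModule [NeZero d] (hQ : IsPrimitiveRoot (q ^ 2) d)
    [IsSimpleModule (Uq q d) S] :
    ∃ (i : ZMod d) (u : ℕ) (_ : u < d) (e : Module.Basis (Fin (u + 1)) ℂ S),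
      IsStringBasis (endE q d S) (endK q d S) ((q ^ 2) ^ i.val) e ∧
        ∀ m, 1 ≤ m → m ≤ u → lowerCoeff q ((q ^ 2) ^ i.val) m ≠ 0 := by
  classical
  have h := isUqTriple_end q d S
  have : Nontrivial S := IsSimpleModule.nontrivial (Uq q d) S
  -- the last nonzero power of `F` takes some weight vector to a lowest weight vector
  have hex : ∃ k, endF q d S ^ k = 0 := ⟨d, h.F_pow⟩
  obtain ⟨k, hk⟩ : ∃ k, Nat.find hex = k + 1 := by
    refine Nat.exists_eq_succ_of_ne_zero fun h0 => ?_
    have h1 := (Nat.find_eq_zero hex).mp h0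
    rw [pow_zero] at h1
    exact one_ne_zero h1
  have hF : endF q d S ^ (k + 1) = 0 := hk ▸ Nat.find_spec hex
  obtain ⟨w, hw, y, hy, hyk⟩ :=
    exists_weight_vector hQ h.K_pow (Nat.find_min hex (m := k) (by omega))
  obtain ⟨x, hxdef⟩ : ∃ x, x = (endF q d S ^ k) y := ⟨_, rfl⟩
  have hx0 : x ≠ 0 := hxdef ▸ hyk
  have hFx : endF q d S x = 0 := by
    rw [hxdef, ← end_pow_succ_apply, hF, LinearMap.zero_apply]
  have hwt : ∀ k, endK q d S ((endF q d S ^ k) y) =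
      ((q ^ 2) ^ w * ((q ^ 2)⁻¹) ^ k) • (endF q d S ^ k) y := by
    intro k
    induction k with
    | zero => simpa using hy
    | succ k ih =>
      rw [end_pow_succ_apply, h.weight_F ih, pow_succ (q ^ 2)⁻¹, mul_assoc]
  have hx := hwt k
  rw [← hxdef] at hx
  obtain ⟨n, hnd, hn⟩ := hQ.eq_pow_of_pow_eq_one (h.weight_pow_eq_one hx hx0)
  rw [← hn] at hx
  have hexE : ∃ k, (endE q d S ^ k) x = 0 := ⟨d, by rw [h.E_pow, LinearMap.zero_apply]⟩
  obtain ⟨u, hu⟩ : ∃ u, Nat.find hexE = u + 1 := by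
    refine Nat.exists_eq_succ_of_ne_zero fun h0 => hx0 ?_
    simpa using (Nat.find_eq_zero hexE).mp h0
  have hxu1 : (endE q d S ^ (u + 1)) x = 0 := hu ▸ Nat.find_spec hexE
  have hxu : (endE q d S ^ u) x ≠ 0 := Nat.find_min hexE (by omega)
  have hud : u < d := by
    by_contra! hdu
    exact hxu (Module.End.pow_map_zero_of_le hdu (by rw [h.E_pow, LinearMap.zero_apply]))
  have hspan : ⊤ ≤ Submodule.span ℂ
      (Set.range fun j : Fin (u + 1) => (endE q d S ^ (j : ℕ)) x) := by
    rw [← span_string_eq_top hx0 hx hFx, Submodule.span_le]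
    rintro _ ⟨j, rfl⟩
    rcases lt_or_ge j (u + 1) with hj | hj
    · exact Submodule.subset_span ⟨⟨j, hj⟩, rfl⟩
    · simp only [Module.End.pow_map_zero_of_le hj hxu1]
      exact Submodule.zero_mem _
  obtain ⟨e, -, he⟩ := h.exists_isStringBasis hQ hud hx hxu hxu1 hspan
  refine ⟨(n : ZMod d), u, hud, e, ?_, ?_⟩
  · rwa [ZMod.val_natCast_of_lt hnd]
  · rw [ZMod.val_natCast_of_lt hnd]
    intro m hm1 hmu hm
    obtain ⟨l, rfl⟩ := Nat.exists_eq_add_of_le' hm1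
    have hFl : endF q d S ((endE q d S ^ (l + 1)) x) = 0 := by
      rw [h.F_E_pow_succ (NeZero.pos d) hx (by rw [hFx, map_zero]), hm, zero_smul]
    have h1 := span_string_eq_top (E_pow_ne_zero_of_le hxu hmu) (h.weight_E_pow hx (l + 1)) hFl
    -- `Eᵘ` kills the span of the shorter string, but not `x`
    have h2 : ⊤ ≤ LinearMap.ker (endE q d S ^ u) := by
      rw [← h1, Submodule.span_le]
      rintro _ ⟨j, rfl⟩
      simp only [SetLike.mem_coe, LinearMap.mem_ker]
      rw [← Module.End.mul_apply, ← Module.End.mul_apply, ← pow_add, ← pow_add]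
      exact Module.End.pow_map_zero_of_le (by omega) hxu1
    exact hxu (LinearMap.mem_ker.mp (h2 Submodule.mem_top))

end Simple

end Uq

/-! ### The two families -/

namespace Uq

section Arithmetic

variable {q : ℂ} {d : ℕ}

theorem isPrimitiveRoot_sq {n : ℕ} (hn : 3 ≤ n) (hq : IsPrimitiveRoot q n)
    (hd : d = if Odd n then n else n / 2) : IsPrimitiveRoot (q ^ 2) d ∧ 2 ≤ d := by
  split_ifs at hd with hodd
  · subst hd
    exact ⟨hq.pow_of_coprime 2 (Nat.coprime_two_left.mpr hodd), by omega⟩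
  · rw [Nat.not_odd_iff_even] at hodd
    subst hd
    have hn2 : 2 ≤ n / 2 := by
      obtain ⟨k, hk⟩ := hodd
      omega
    exact ⟨hq.pow_of_dvd two_ne_zero hodd.two_dvd, hn2⟩

theorem natCast_ne_zero_of_lt {m : ℕ} (h1 : 1 ≤ m) (h2 : m < d) : (m : ZMod d) ≠ 0 := by
  rw [Ne, ZMod.natCast_eq_zero_iff]
  exact Nat.not_dvd_of_pos_of_lt h1 h2

theorem eq_val_of_natCast_eq {m : ℕ} (hm : m < d) {a : ZMod d} (h : (m : ZMod d) = a) :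
    m = a.val := by
  rw [← h, ZMod.val_natCast_of_lt hm]

variable [NeZero d]

theorem val_eq_pred_iff (a : ZMod d) : a.val = d - 1 ↔ a = -1 := by
  have hd : ((d - 1 : ℕ) : ZMod d) = -1 := by
    rw [Nat.cast_sub (NeZero.pos d), ZMod.natCast_self, Nat.cast_one, zero_sub]
  constructor
  · intro h
    rw [← ZMod.natCast_zmod_val a, h, hd]
  · intro h
    exact (eq_val_of_natCast_eq (Nat.sub_lt (NeZero.pos d) one_pos) (hd.trans h.symm)).symm

/-- The congruence `2 * i = 1` has a solution only for odd `d`, and then only one. -/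
theorem two_mul_eq_one_iff (hd : 2 ≤ d) (i : ZMod d) :
    2 * i = 1 ↔ Odd d ∧ i = (((d + 1) / 2 : ℕ) : ZMod d) := by
  have key : Odd d → 2 * (((d + 1) / 2 : ℕ) : ZMod d) = 1 := by
    intro hodd
    have h1 : 2 * ((d + 1) / 2) = d + 1 := by
      obtain ⟨k, rfl⟩ := hodd
      omega
    have h2 : ((2 * ((d + 1) / 2) : ℕ) : ZMod d) = ((d + 1 : ℕ) : ZMod d) := by rw [h1]
    push_cast at h2
    rwa [ZMod.natCast_self, zero_add] at h2
  constructor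
  · intro h
    have hodd : Odd d := by
      by_contra heven
      rw [Nat.not_odd_iff_even] at heven
      have h1 : ((2 * i.val : ℕ) : ZMod d) = ((1 : ℕ) : ZMod d) := by
        push_cast
        rw [ZMod.natCast_zmod_val, h]
      rw [ZMod.natCast_eq_natCast_iff] at h1
      have h2 : 2 * i.val ≡ 1 [MOD 2] := h1.of_dvd heven.two_dvd
      unfold Nat.ModEq at h2
      omega
    refine ⟨hodd, ?_⟩
    have h1 := key hodd
    generalize (((d + 1) / 2 : ℕ) : ZMod d) = t at h1
    linear_combination i * (-h1) + t * h
  · rintro ⟨hodd, rfl⟩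
    exact key hodd

theorem lowerCoeff_val_succ (hQ : IsPrimitiveRoot (q ^ 2) d) (hd : 2 ≤ d) (i : ZMod d) :
    lowerCoeff q ((q ^ 2) ^ i.val) ((-2 * i).val + 1) = 0 := by
  rw [lowerCoeff_eq_zero_iff hQ hd]
  right
  push_cast
  rw [ZMod.natCast_zmod_val]
  ring

theorem lowerCoeff_self (hQ : IsPrimitiveRoot (q ^ 2) d) (hd : 2 ≤ d) (i : ZMod d) :
    lowerCoeff q ((q ^ 2) ^ i.val) (d - 1 + 1) = 0 := by
  rw [lowerCoeff_eq_zero_iff hQ hd, Nat.sub_add_cancel (by omega), ZMod.natCast_self]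
  exact Or.inl rfl

/-- The condition `a_{u+1} = 0`, which allows a string with an action of `F` to end at `Eᵘ`, leaves
only the two lengths of the families. -/
theorem eq_val_or_eq_of_lowerCoeff_succ_eq_zero (hQ : IsPrimitiveRoot (q ^ 2) d) (hd : 2 ≤ d)
    {i : ZMod d} {u : ℕ} (hud : u < d) (h : lowerCoeff q ((q ^ 2) ^ i.val) (u + 1) = 0) :
    u = (-2 * i).val ∨ u = d - 1 := by
  rcases (lowerCoeff_eq_zero_iff hQ hd i _).mp h with h1 | h1
  · right
    have := Nat.le_of_dvd (Nat.succ_pos u) ((ZMod.natCast_eq_zero_iff _ _).mp h1)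
    omega
  · left
    push_cast at h1
    exact eq_val_of_natCast_eq hud (by linear_combination h1)

theorem lowerCoeff_ne_zero_of_le_val (hQ : IsPrimitiveRoot (q ^ 2) d) (hd : 2 ≤ d) (i : ZMod d)
    (m : ℕ) (hm1 : 1 ≤ m) (hm : m ≤ (-2 * i).val) : lowerCoeff q ((q ^ 2) ^ i.val) m ≠ 0 := by
  have hlt := ZMod.val_lt (-2 * i)
  intro h
  rcases (lowerCoeff_eq_zero_iff hQ hd i _).mp h with h1 | h1
  · exact natCast_ne_zero_of_lt hm1 (by omega) h1
  · obtain ⟨k, rfl⟩ := Nat.exists_eq_add_of_le' hm1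
    push_cast at h1
    have := eq_val_of_natCast_eq (m := k) (a := -2 * i) (by omega) (by linear_combination h1)
    omega

theorem exists_lowerCoeff_eq_zero (hQ : IsPrimitiveRoot (q ^ 2) d) (hd : 2 ≤ d) {i : ZMod d}
    (hi : (-2 * i).val ≠ d - 1) :
    ∃ m, 1 ≤ m ∧ m ≤ d - 1 ∧ lowerCoeff q ((q ^ 2) ^ i.val) m = 0 :=
  ⟨(-2 * i).val + 1, by omega, by have := ZMod.val_lt (-2 * i); omega, lowerCoeff_val_succ hQ hd i⟩

end Arithmetic

/-- The modules `M_i^{-2i}` have exactly one extension, and it is simple. -/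
theorem IsTypeM.exists_unique_extension {q : ℂ} {d : ℕ} [NeZero d]
    (hQ : IsPrimitiveRoot (q ^ 2) d) (hd : 2 ≤ d) {i : ZMod d} {M : Type v} [AddCommGroup M]
    [Module ℂ M] [Module (plus q d) M] [IsScalarTower ℂ (plus q d) M]
    (hM : IsTypeM q d i (-2 * i).val M) :
    ∃ X : Extension q d M, (∀ Y : Extension q d M, Y = X) ∧
      IsSimpleModule (Uq q d) X.Carrier := by
  obtain ⟨e, he⟩ := hM
  rw [isStandardBasis_iff] at he
  have hud := ZMod.val_lt (-2 * i)
  have ha := lowerCoeff_ne_zero_of_le_val hQ hd i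
  obtain ⟨X, -⟩ := he.exists_extension hQ hud (lowerCoeff_val_succ hQ hd i) 0 (Or.inl rfl)
  refine ⟨X, fun Y => he.extension_eq hQ hud ?_, he.isSimpleModule hQ hud ha X⟩
  rw [he.F_zero_eq_zero X.isUqTriple hQ hud ha, he.F_zero_eq_zero Y.isUqTriple hQ hud ha]

end Uq

open Uq in
theorem theorem4p1 (q : ℂ) (n d : ℕ) (hn : 3 ≤ n) (hn4 : n ≠ 4) (hq : IsPrimitiveRoot q n)
    (hd : d = if Odd n then n else n / 2) :
    -- the extendable indecomposable modules are exactly the members of the two families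
    (∀ (M : Type v) [AddCommGroup M] [Module ℂ M] [Module (Uq.plus q d) M]
        [IsScalarTower ℂ (Uq.plus q d) M],
      (Uq.IsIndecomposable (Uq.plus q d) M ∧ Uq.IsExtendable q d M) ↔
        ((∃ i : ZMod d, Uq.IsTypeM q d i (-2 * i).val M) ∨
          ∃ i : ZMod d, Uq.IsTypeP q d i M)) ∧
    -- the modules of both families exist
    (∀ i : ZMod d, ∀ u ∈ ({(-2 * i).val, d - 1} : Set ℕ),
      ∃ (M : Type v) (_ : AddCommGroup M) (_ : Module ℂ M) (_ : Module (Uq.plus q d) M)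
        (_ : IsScalarTower ℂ (Uq.plus q d) M), Uq.IsTypeM q d i u M) ∧
    -- first family: a unique extension, and it is simple
    (∀ (i : ZMod d) (M : Type v) [AddCommGroup M] [Module ℂ M] [Module (Uq.plus q d) M]
        [IsScalarTower ℂ (Uq.plus q d) M], Uq.IsTypeM q d i (-2 * i).val M →
      ∃ X : Uq.Extension q d M, (∀ Y : Uq.Extension q d M, Y = X) ∧
        IsSimpleModule (Uq q d) X.Carrier) ∧
    -- every simple module over the whole algebra is obtained in this way, for exactly one `i`
    (∀ (S : Type v) [AddCommGroup S] [Module ℂ S] [Module (Uq q d) S]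
        [IsScalarTower ℂ (Uq q d) S], IsSimpleModule (Uq q d) S →
      ∃! i : ZMod d, Uq.IsTypeM q d i (-2 * i).val S) ∧
    -- second family, general case: there are two non-isomorphic extensions; more precisely
    -- the extensions are pairwise non-isomorphic and parametrized by the complex numbers
    (∀ (i : ZMod d), ¬ (Odd d ∧ i = (((d + 1) / 2 : ℕ) : ZMod d)) →
      ∀ (M : Type v) [AddCommGroup M] [Module ℂ M] [Module (Uq.plus q d) M]
        [IsScalarTower ℂ (Uq.plus q d) M] (e : Module.Basis (Fin (d - 1 + 1)) ℂ M),
        Uq.IsStandardBasis q d i (d - 1) e →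
        (∃ X Y : Uq.Extension q d M, ¬ X.Iso Y) ∧
        (∀ c : ℂ, ∃! X : Uq.Extension q d M,
          X.act (Uq.gen q d UqGen.F) (e 0) = c • e (Fin.last (d - 1))) ∧
        (∀ X : Uq.Extension q d M, ∃ c : ℂ,
          X.act (Uq.gen q d UqGen.F) (e 0) = c • e (Fin.last (d - 1))) ∧
        (∀ X Y : Uq.Extension q d M, X.Iso Y → X = Y)) ∧
    -- second family, the exceptional module: a unique extension
    (∀ (i : ZMod d), Odd d → i = (((d + 1) / 2 : ℕ) : ZMod d) →
      ∀ (M : Type v) [AddCommGroup M] [Module ℂ M] [Module (Uq.plus q d) M]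
        [IsScalarTower ℂ (Uq.plus q d) M], Uq.IsTypeP q d i M →
        ∃ X : Uq.Extension q d M, ∀ Y : Uq.Extension q d M, Y = X) := by
  have hd0 : d ≠ 0 := by
    split_ifs at hd <;> omega
  have : NeZero d := ⟨hd0⟩
  obtain ⟨hQ, hd2⟩ := isPrimitiveRoot_sq hn hq hd
  clear hd hn hn4 hq n
  have hpred : d - 1 < d := by omega
  refine ⟨?_, ?_, ?_, ?_, ?_, ?_⟩
  · intro M _ _ _ _
    constructor
    · rintro ⟨hM, ⟨X⟩⟩
      obtain ⟨i, u, hud, e, he⟩ := hM.exists_isStringBasis hQ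
      have hu := he.lowerCoeff_succ_eq_zero X.isUqTriple hQ hud
      rcases eq_val_or_eq_of_lowerCoeff_succ_eq_zero hQ hd2 hud hu with rfl | rfl
      · exact Or.inl ⟨i, e, isStandardBasis_iff.mpr he⟩
      · exact Or.inr ⟨i, e, isStandardBasis_iff.mpr he⟩
    · rintro (⟨i, e, he⟩ | ⟨i, e, he⟩)
      · rw [isStandardBasis_iff] at he
        obtain ⟨X, -⟩ := he.exists_extension hQ (ZMod.val_lt _) (lowerCoeff_val_succ hQ hd2 i) 0
          (Or.inl rfl)
        exact ⟨he.isIndecomposable, ⟨X⟩⟩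
      · rw [isStandardBasis_iff] at he
        obtain ⟨X, -⟩ := he.exists_extension hQ hpred (lowerCoeff_self hQ hd2 i) 0 (Or.inl rfl)
        exact ⟨he.isIndecomposable, ⟨X⟩⟩
  · rintro i u (rfl | rfl)
    · exact exists_isTypeM hQ i (ZMod.val_lt _) (lowerCoeff_val_succ hQ hd2 i)
    · exact exists_isTypeM hQ i hpred (lowerCoeff_self hQ hd2 i)
  · exact fun i M _ _ _ _ hM => hM.exists_unique_extension hQ hd2
  · intro S _ _ _ _ hS
    obtain ⟨i, u, hud, e, he, ha⟩ := exists_isStringBasis_of_isSimpleModule hQ (S := S)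
    have hu := he.lowerCoeff_succ_eq_zero (isUqTriple_end q d S) hQ hud
    have hui : u = (-2 * i).val := by
      rcases eq_val_or_eq_of_lowerCoeff_succ_eq_zero hQ hd2 hud hu with h1 | h1
      · exact h1
      · by_contra h2
        obtain ⟨m, hm1, hmu, hm⟩ := exists_lowerCoeff_eq_zero hQ hd2 (h1 ▸ Ne.symm h2)
        exact ha m hm1 (h1 ▸ hmu) hm
    subst hui
    refine ⟨i, ⟨e, isStandardBasis_iff.mpr he⟩, ?_⟩
    rintro j ⟨e', he'⟩
    rw [isStandardBasis_iff] at he'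
    have h1 := (he'.unique he (isBorelPair_end q d S) (hQ.ne_zero hd0)).2
    rw [hQ.pow_eq_pow_iff_natCast_zmod_eq] at h1
    simpa using h1
  · intro i hi M _ _ _ _ e he
    rw [isStandardBasis_iff] at he
    have hi' : (-2 * i).val ≠ d - 1 := by
      rw [Ne, val_eq_pred_iff]
      intro h
      exact hi ((two_mul_eq_one_iff hd2 i).mp (by linear_combination -h))
    have hex : ∀ c : ℂ, ∃ X : Extension q d M,
        X.act (gen q d UqGen.F) (e 0) = c • e (Fin.last (d - 1)) := fun c =>
      he.exists_extension hQ hpred (lowerCoeff_self hQ hd2 i) c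
        (Or.inr ⟨by omega, exists_lowerCoeff_eq_zero hQ hd2 hi'⟩)
    have hiso : ∀ X Y : Extension q d M, X.Iso Y → X = Y := fun X Y h =>
      he.extension_eq_of_iso hQ hpred h
    refine ⟨?_, ?_, ?_, hiso⟩
    · obtain ⟨X, hX⟩ := hex 0
      obtain ⟨Y, hY⟩ := hex 1
      refine ⟨X, Y, fun h => ?_⟩
      rw [hiso X Y h, hY, zero_smul, one_smul] at hX
      exact e.ne_zero _ hX
    · intro c
      obtain ⟨X, hX⟩ := hex c
      exact ⟨X, hX, fun Y hY => he.extension_eq hQ hpred (hY.trans hX.symm)⟩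
    · intro X
      obtain ⟨c, hc, -⟩ := he.exists_F_zero X.isUqTriple hQ hpred
      exact ⟨c, hc⟩
  · -- here `P_i` is also the member `M_i^{d-1}` of the first family
    intro i hodd hi M _ _ _ _ hM
    have h1 : (-2 * i).val = d - 1 := by
      rw [val_eq_pred_iff]
      linear_combination -(two_mul_eq_one_iff hd2 i).mpr ⟨hodd, hi⟩
    rw [IsTypeP, ← h1] at hM
    obtain ⟨X, hX, -⟩ := hM.exists_unique_extension hQ hd2
    exact ⟨X, hX⟩
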